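/- **Proposition.** Let $\mathbb B^4$ be the open Euclidean unit ball in $\mathbb R^4$ with boundary $\mathbb S^3$, outward unit normal $\nu$, and let $$P^{3,b}=-\tfrac12\,\partial_\nu\Delta-\Delta_{\mathbb S^3}\partial_\nu-\Delta_{\mathbb S^3}\quad\text{on }\mathbb S^3 .$$ Consider the eigenvalue problem: find $\Lambda\in\mathbb R$ and $0\not\equiv\varphi\in H^2(\mathbb B^4)$ with $$\Delta^2\varphi=0\ \text{ in }\mathbb B^4,\qquad P^{3,b}\varphi=\Lambda\varphi\ \text{ and }\ \partial_\nu\varphi=0\ \text{ on }\mathbb S^3 ,$$ where $\Delta^2\varphi=0$ holds in the sense of distributions, and boundary values and $P^{3,b}\varphi$ are understood in the weak sense given by Green's formula. Then: 1. The eigenvalues are exactly the numbers $\Lambda_{(k)}=k(k+1)(k+2)$, $k=0,1,2,\dots$ 2. The eigenspace of $\Lambda_{(k)}$ has dimension $(k+1)^2$. 3. Call $\psi\in H^1(\mathbb B^4)$ a Steklov solution for $k$ if $\Delta\psi=0$ in $\mathbb B^4$ and $\partial_\nu\psi=k\psi$ on $\mathbb S^3$. Every such $\psi$ has a unique extension $\varphi\in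 H^2(\mathbb B^4)$ of its boundary values with $\Delta^2\varphi=0$ in $\mathbb B^4$, $\varphi=\psi$ and $\partial_\nu\varphi=0$ on $\mathbb S^3$, and the eigenspace of $\Lambda_{(k)}$ consists exactly of these extensions. 4. Explicitly, the Steklov solutions for $k$ are the homogeneous harmonic polynomials $p$ of degree $k$, and the eigenspace of $\Lambda_{(k)}$ consists of the functions $\varphi(x)=\tfrac12\bigl(k+2-k|x|^2\bigr)\,p(x)$ with such $p$. In particular the boundary values of the eigenfunctions for $\Lambda_{(k)}$ are the spherical harmonics of degree $k$. 5. For every $\Lambda\in\mathbb R$, the $H^2$ solutions $\varphi$ (zero included) are exactly the functions on $\mathbb B^4$ that are restrictions of some $f\in C^\infty(\mathbb R^4)$ satisfying the three equations pointwise. 6. Listed in nondecreasing order and repeated according to multiplicity, the spectrum begins $$0=\Lambda_0<6=\Lambda_1=\Lambda_2=\Lambda_3=\Lambda_4<24=\Lambda_5\le\cdots.$$ -/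

import Mathlib

open MeasureTheory Metric Set
open scoped ContDiff

noncomputable section

namespace FlatBall

/-- Euclidean four-space. -/
abbrev E4 : Type := EuclideanSpace ℝ (Fin 4)

/-- Lebesgue measure on the open unit ball of `ℝ⁴`. -/
abbrev ballMeasure : Measure E4 := volume.restrict (ball (0 : E4) 1)

/-- The unit sphere `S³` in `ℝ⁴`. -/
abbrev S3 : Type := sphere (0 : E4) 1

/-- The surface measure of `S³` (of total mass `2 π ^ 2`). -/
abbrev sphereMeasure : Measure S3 := (volume : Measure E4).toSphere

/-- `L²(B⁴)`: classes of functions modulo almost everywhere equality. -/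
abbrev L2Ball : Type := Lp ℝ 2 ballMeasure

/-- `L²(S³)`. -/
abbrev L2Sphere : Type := Lp ℝ 2 sphereMeasure

/-- The `i`-th partial derivative of a function on `ℝ⁴`. -/
def partialD (i : Fin 4) (f : E4 → ℝ) (x : E4) : ℝ :=
  fderiv ℝ f x (EuclideanSpace.single i (1 : ℝ))

/-- The Euclidean Laplacian. -/
def lap (f : E4 → ℝ) : E4 → ℝ := Laplacian.laplacian f

/-- The radial derivative `x ↦ ⟨∇ f (x), x⟩`; on `S³` this is the outward normal derivative. -/
def normalD (f : E4 → ℝ) (x : E4) : ℝ := fderiv ℝ f x x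

/-- The Laplace–Beltrami operator of the round sphere `S³`, applied to the restriction of `f` to
`S³`: at a point of `S³` it is the Euclidean Laplacian of the extension of `f|_{S³}` that is
constant along rays. -/
def sphereLap (f : E4 → ℝ) : E4 → ℝ := lap fun y => f (‖y‖⁻¹ • y)

/-- The boundary operator `P^{3,b} = -½ ∂_ν Δ - Δ_{S³} ∂_ν - Δ_{S³}` of the flat ball, on functions
that are smooth up to the boundary. -/
def P3b (f : E4 → ℝ) (x : E4) : ℝ :=
  -(1 / 2) * normalD (lap f) x - sphereLap (normalD f) x - sphereLap f x

/-- `f`, smooth up to the boundary, solves pointwise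
`Δ² f = 0` in `B⁴`, `P^{3,b} f = Λ f` and `∂_ν f = 0` on `S³`. -/
def IsClassicalSolution (Λ : ℝ) (f : E4 → ℝ) : Prop :=
  ContDiff ℝ ∞ f ∧
  (∀ x ∈ ball (0 : E4) 1, lap (lap f) x = 0) ∧
  (∀ x ∈ sphere (0 : E4) 1, P3b f x = Λ * f x) ∧
  (∀ x ∈ sphere (0 : E4) 1, normalD f x = 0)

/-! ### Integration against smooth functions -/

/-- `∫_{B⁴} u f`. -/
def ballInt (u : L2Ball) (f : E4 → ℝ) : ℝ := ∫ x, u x * f x ∂ballMeasure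

/-- `∫_{S³} t f`. -/
def sphereInt (t : L2Sphere) (f : E4 → ℝ) : ℝ := ∫ x, t x * f (x : E4) ∂sphereMeasure

instance : IsFiniteMeasure ballMeasure :=
  ⟨by simpa [ballMeasure] using measure_ball_lt_top⟩

lemma ball_integrable (u : L2Ball) {f : E4 → ℝ} (hf : Continuous f) :
    Integrable (fun x => u x * f x) ballMeasure := by
  obtain ⟨C, hC⟩ := (isCompact_closedBall (0 : E4) 1).exists_bound_of_continuousOn hf.continuousOn
  refine ((Lp.memLp u).integrable (by norm_num)).mul_bdd (c := C)
    hf.aestronglyMeasurable ?_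
  filter_upwards [ae_restrict_mem measurableSet_ball] with x hx
  exact hC x (ball_subset_closedBall hx)

lemma sphere_integrable (t : L2Sphere) {f : E4 → ℝ} (hf : ContinuousOn f (sphere (0 : E4) 1)) :
    Integrable (fun x : S3 => t x * f (x : E4)) sphereMeasure := by
  obtain ⟨C, hC⟩ := (isCompact_sphere (0 : E4) 1).exists_bound_of_continuousOn hf
  exact ((Lp.memLp t).integrable (by norm_num)).mul_bdd (c := C)
    (hf.domRestrict.aestronglyMeasurable) (Filter.Eventually.of_forall fun x => hC x x.2)

lemma ballInt_add (u v : L2Ball) {f : E4 → ℝ} (hf : Continuous f) :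
    ballInt (u + v) f = ballInt u f + ballInt v f := by
  unfold ballInt
  rw [← integral_add (ball_integrable u hf) (ball_integrable v hf)]
  refine integral_congr_ae ?_
  filter_upwards [Lp.coeFn_add u v] with x hx
  rw [hx, Pi.add_apply, add_mul]

lemma ballInt_smul (c : ℝ) (u : L2Ball) (f : E4 → ℝ) :
    ballInt (c • u) f = c * ballInt u f := by
  unfold ballInt
  rw [← integral_const_mul]
  refine integral_congr_ae ?_
  filter_upwards [Lp.coeFn_smul c u] with x hx
  rw [hx, Pi.smul_apply, smul_eq_mul, mul_assoc]

lemma sphereInt_add (s t : L2Sphere) {f : E4 → ℝ} (hf : ContinuousOn f (sphere (0 : E4) 1)) :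
    sphereInt (s + t) f = sphereInt s f + sphereInt t f := by
  unfold sphereInt
  rw [← integral_add (sphere_integrable s hf) (sphere_integrable t hf)]
  refine integral_congr_ae ?_
  filter_upwards [Lp.coeFn_add s t] with x hx
  rw [hx, Pi.add_apply, add_mul]

lemma sphereInt_smul (c : ℝ) (t : L2Sphere) (f : E4 → ℝ) :
    sphereInt (c • t) f = c * sphereInt t f := by
  unfold sphereInt
  rw [← integral_const_mul]
  refine integral_congr_ae ?_
  filter_upwards [Lp.coeFn_smul c t] with x hx
  rw [hx, Pi.smul_apply, smul_eq_mul, mul_assoc]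

lemma continuous_partialD (i : Fin 4) {f : E4 → ℝ} (hf : ContDiff ℝ ∞ f) :
    Continuous (partialD i f) :=
  (hf.continuous_fderiv (by simp)).clm_apply continuous_const

lemma continuous_lap {f : E4 → ℝ} (hf : ContDiff ℝ ∞ f) : Continuous (lap f) := by
  have h : lap f = fun x => ∑ i, iteratedFDeriv ℝ 2 f x
      ![stdOrthonormalBasis ℝ E4 i, stdOrthonormalBasis ℝ E4 i] := by
    unfold lap
    rw [InnerProductSpace.laplacian_eq_iteratedFDeriv_stdOrthonormalBasis]
  rw [h]
  have h2 : Continuous (iteratedFDeriv ℝ 2 f) :=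
    hf.continuous_iteratedFDeriv (WithTop.coe_le_coe.2 le_top)
  refine continuous_finsetSum _ fun i _ => ?_
  have h3 := (ContinuousMultilinearMap.apply ℝ (fun _ : Fin 2 => E4) ℝ
    ![stdOrthonormalBasis ℝ E4 i, stdOrthonormalBasis ℝ E4 i]).continuous.comp h2
  exact h3

lemma continuousOn_sphereLap {f : E4 → ℝ} (hf : ContDiff ℝ ∞ f) :
    ContinuousOn (sphereLap f) (sphere (0 : E4) 1) := by
  intro x hx
  have hx0 : x ≠ 0 := by
    rintro rfl
    simp at hx
  set g : E4 → ℝ := fun y => f (‖y‖⁻¹ • y) with hg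
  have hgx : ContDiffAt ℝ 2 g x := by
    refine ContDiffAt.comp x (hf.contDiffAt.of_le (WithTop.coe_le_coe.2 le_top)) ?_
    exact ((contDiffAt_norm ℝ hx0).inv (norm_ne_zero_iff.mpr hx0)).smul contDiffAt_id
  have h : sphereLap f = fun y => ∑ i, iteratedFDeriv ℝ 2 g y
      ![stdOrthonormalBasis ℝ E4 i, stdOrthonormalBasis ℝ E4 i] := by
    unfold sphereLap lap
    rw [InnerProductSpace.laplacian_eq_iteratedFDeriv_stdOrthonormalBasis]
  rw [h]
  have h2 : ContinuousAt (iteratedFDeriv ℝ 2 g) x :=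
    hgx.continuousAt_iteratedFDeriv (by norm_num)
  refine ContinuousAt.continuousWithinAt (tendsto_finsetSum _ fun i _ => ?_)
  have h3 := (ContinuousMultilinearMap.apply ℝ (fun _ : Fin 2 => E4) ℝ
    ![stdOrthonormalBasis ℝ E4 i, stdOrthonormalBasis ℝ E4 i]).continuous.continuousAt.comp h2
  exact h3

/-! ### Weak derivatives, Sobolev spaces and traces on the ball -/

/-- Test functions: smooth, with compact support in the open unit ball. -/
def IsTest (η : E4 → ℝ) : Prop :=
  ContDiff ℝ ∞ η ∧ HasCompactSupport η ∧ tsupport η ⊆ ball (0 : E4) 1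

/-- `v` is the weak partial derivative `∂_i u` in `B⁴`. -/
def HasWeakPartial (i : Fin 4) (u v : L2Ball) : Prop :=
  ∀ η, IsTest η → ballInt u (partialD i η) = -ballInt v η

/-- `g` is the weak gradient of `u` in `B⁴`. -/
def HasWeakGrad (u : L2Ball) (g : Fin 4 → L2Ball) : Prop := ∀ i, HasWeakPartial i u (g i)

/-- `w = Δ u` in the sense of distributions in `B⁴`. -/
def HasWeakLap (u w : L2Ball) : Prop :=
  ∀ η, IsTest η → ballInt u (lap η) = ballInt w η

/-- `u ∈ H²(B⁴)`: `u` has weak derivatives of orders one and two in `L²`. -/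
def MemH2 (u : L2Ball) : Prop :=
  ∃ g, HasWeakGrad u g ∧ ∀ i, ∃ h, HasWeakGrad (g i) h

/-- `u ∈ H¹(B⁴)` and `t` is its trace on `S³`, that is,
`∫_B u ∂_i η + ∫_B (∂_i u) η = ∫_{S³} t η ν_i` for all `η` smooth up to the boundary. -/
def HasTrace (u : L2Ball) (t : L2Sphere) : Prop :=
  ∃ g, HasWeakGrad u g ∧ ∀ i, ∀ η : E4 → ℝ, ContDiff ℝ ∞ η →
    ballInt u (partialD i η) + ballInt (g i) η = sphereInt t (fun x => η x * x i)

/-- `u ∈ H¹(B⁴)`, `Δ u ∈ L²(B⁴)` and `n = ∂_ν u` on `S³`, that is,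
`∫_B ∇u · ∇η + ∫_B (Δ u) η = ∫_{S³} n η` for all `η` smooth up to the boundary. For `u ∈ H²(B⁴)`
this is the same as `n = ∑ i, ν_i ∂_i u` with `∂_i u` taken in the sense of traces. -/
def HasNormalDeriv (u : L2Ball) (n : L2Sphere) : Prop :=
  ∃ g w, HasWeakGrad u g ∧ HasWeakLap u w ∧ ∀ η : E4 → ℝ, ContDiff ℝ ∞ η →
    (∑ i, ballInt (g i) (partialD i η)) + ballInt w η = sphereInt n η

/-- `Δ² u = 0` in `B⁴` (in the sense of distributions, with `Δ u ∈ L²`). -/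
def IsBiharmonic (u : L2Ball) : Prop := ∃ w, HasWeakLap u w ∧ HasWeakLap w 0

/-- `p = P^{3,b} u = -½ ∂_ν Δ u - Δ_{S³} ∂_ν u - Δ_{S³} u` on `S³` in the weak sense, for `u` with
`Δ u, Δ² u ∈ L²(B⁴)`. If `u` and `ψ` are smooth up to the boundary and `∂_ν ψ = 0` then
`-∫_{S³} (∂_ν Δ u) ψ = ∫_B Δu Δψ - ∫_B (Δ² u) ψ` by Green's formula, and `Δ_{S³}` is symmetric;
such `ψ` attain every smooth function on `S³` as boundary values. -/
def HasP3b (u : L2Ball) (p : L2Sphere) : Prop :=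
  ∃ w z t n, HasWeakLap u w ∧ HasWeakLap w z ∧ HasTrace u t ∧ HasNormalDeriv u n ∧
    ∀ ψ : E4 → ℝ, ContDiff ℝ ∞ ψ → (∀ x ∈ sphere (0 : E4) 1, normalD ψ x = 0) →
      (1 / 2) * (ballInt w (lap ψ) - ballInt z ψ)
        - sphereInt n (sphereLap ψ) - sphereInt t (sphereLap ψ) = sphereInt p ψ

/-! ### The two eigenvalue problems -/

/-- `φ ∈ H²(B⁴)` solves `Δ² φ = 0` in `B⁴`, `P^{3,b} φ = Λ φ` and `∂_ν φ = 0` on `S³`. -/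
def IsSolution (Λ : ℝ) (φ : L2Ball) : Prop :=
  MemH2 φ ∧ IsBiharmonic φ ∧ (∃ t, HasTrace φ t ∧ HasP3b φ (Λ • t)) ∧ HasNormalDeriv φ 0

/-- `ψ ∈ H¹(B⁴)` solves `Δ ψ = 0` in `B⁴`, `∂_ν ψ = μ ψ` on `S³` (the Steklov problem). -/
def IsSteklovSolution (μ : ℝ) (ψ : L2Ball) : Prop :=
  HasWeakLap ψ 0 ∧ ∃ t, HasTrace ψ t ∧ HasNormalDeriv ψ (μ • t)

/-- `Λ` is an eigenvalue: the problem has a solution `φ ≢ 0`. -/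
def IsEigenvalue (Λ : ℝ) : Prop := ∃ φ : L2Ball, φ ≠ 0 ∧ IsSolution Λ φ

/-- `φ` is the biharmonic extension with vanishing normal derivative of the boundary values of
`ψ ∈ H¹(B⁴)`: `φ ∈ H²(B⁴)`, `Δ² φ = 0` in `B⁴`, `∂_ν φ = 0` and `φ = ψ` on `S³`. -/
def IsNeumannBiharmonicExtension (φ ψ : L2Ball) : Prop :=
  MemH2 φ ∧ IsBiharmonic φ ∧ HasNormalDeriv φ 0 ∧ ∃ t, HasTrace ψ t ∧ HasTrace φ t

/-- Homogeneous harmonic polynomials of degree `k` in four variables. -/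
def harmonicPolynomials (k : ℕ) : Set (MvPolynomial (Fin 4) ℝ) :=
  {p | p.IsHomogeneous k ∧ ∑ i, MvPolynomial.pderiv i (MvPolynomial.pderiv i p) = 0}

/-! ### Linearity -/

lemma IsTest.continuous_partialD {η : E4 → ℝ} (h : IsTest η) (i : Fin 4) :
    Continuous (partialD i η) := FlatBall.continuous_partialD i h.1

lemma HasWeakPartial.add {i : Fin 4} {u u' v v' : L2Ball} (h : HasWeakPartial i u v)
    (h' : HasWeakPartial i u' v') : HasWeakPartial i (u + u') (v + v') := by
  intro η hη
  rw [ballInt_add _ _ (hη.continuous_partialD i), ballInt_add _ _ hη.1.continuous, h η hη, h' η hη]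
  ring

lemma HasWeakPartial.smul {i : Fin 4} {u v : L2Ball} (c : ℝ) (h : HasWeakPartial i u v) :
    HasWeakPartial i (c • u) (c • v) := by
  intro η hη
  rw [ballInt_smul, ballInt_smul, h η hη]
  ring

lemma HasWeakGrad.add {u u' : L2Ball} {g g' : Fin 4 → L2Ball} (h : HasWeakGrad u g)
    (h' : HasWeakGrad u' g') : HasWeakGrad (u + u') (g + g') := fun i => (h i).add (h' i)

lemma HasWeakGrad.smul {u : L2Ball} {g : Fin 4 → L2Ball} (c : ℝ) (h : HasWeakGrad u g) :
    HasWeakGrad (c • u) (c • g) := fun i => (h i).smul c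

lemma HasWeakLap.add {u u' w w' : L2Ball} (h : HasWeakLap u w) (h' : HasWeakLap u' w') :
    HasWeakLap (u + u') (w + w') := by
  intro η hη
  rw [ballInt_add _ _ (continuous_lap hη.1), ballInt_add _ _ hη.1.continuous, h η hη, h' η hη]

lemma HasWeakLap.smul {u w : L2Ball} (c : ℝ) (h : HasWeakLap u w) :
    HasWeakLap (c • u) (c • w) := by
  intro η hη
  rw [ballInt_smul, ballInt_smul, h η hη]

lemma MemH2.add {u u' : L2Ball} (h : MemH2 u) (h' : MemH2 u') : MemH2 (u + u') := by
  obtain ⟨g, hg, k⟩ := h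
  obtain ⟨g', hg', k'⟩ := h'
  refine ⟨g + g', hg.add hg', fun i => ?_⟩
  obtain ⟨a, ha⟩ := k i
  obtain ⟨a', ha'⟩ := k' i
  exact ⟨a + a', ha.add ha'⟩

lemma MemH2.smul {u : L2Ball} (c : ℝ) (h : MemH2 u) : MemH2 (c • u) := by
  obtain ⟨g, hg, k⟩ := h
  refine ⟨c • g, hg.smul c, fun i => ?_⟩
  obtain ⟨a, ha⟩ := k i
  exact ⟨c • a, ha.smul c⟩

lemma HasTrace.add {u u' : L2Ball} {t t' : L2Sphere} (h : HasTrace u t) (h' : HasTrace u' t') :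
    HasTrace (u + u') (t + t') := by
  obtain ⟨g, hg, k⟩ := h
  obtain ⟨g', hg', k'⟩ := h'
  refine ⟨g + g', hg.add hg', fun i η hη => ?_⟩
  have hc : Continuous fun x : E4 => η x * x i :=
    hη.continuous.mul (EuclideanSpace.proj (𝕜 := ℝ) i).continuous
  rw [Pi.add_apply, ballInt_add _ _ (continuous_partialD i hη), ballInt_add _ _ hη.continuous,
    sphereInt_add _ _ hc.continuousOn, ← k i η hη, ← k' i η hη]
  ring

lemma HasTrace.smul {u : L2Ball} {t : L2Sphere} (c : ℝ) (h : HasTrace u t) :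
    HasTrace (c • u) (c • t) := by
  obtain ⟨g, hg, k⟩ := h
  refine ⟨c • g, hg.smul c, fun i η hη => ?_⟩
  rw [Pi.smul_apply, ballInt_smul, ballInt_smul, sphereInt_smul, ← k i η hη]
  ring

lemma HasNormalDeriv.add {u u' : L2Ball} {n n' : L2Sphere} (h : HasNormalDeriv u n)
    (h' : HasNormalDeriv u' n') : HasNormalDeriv (u + u') (n + n') := by
  obtain ⟨g, w, hg, hw, k⟩ := h
  obtain ⟨g', w', hg', hw', k'⟩ := h'
  refine ⟨g + g', w + w', hg.add hg', hw.add hw', fun η hη => ?_⟩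
  rw [ballInt_add _ _ hη.continuous, sphereInt_add _ _ hη.continuous.continuousOn, ← k η hη,
    ← k' η hη]
  simp only [Pi.add_apply, ballInt_add _ _ (continuous_partialD _ hη), Finset.sum_add_distrib]
  ring

lemma HasNormalDeriv.smul {u : L2Ball} {n : L2Sphere} (c : ℝ) (h : HasNormalDeriv u n) :
    HasNormalDeriv (c • u) (c • n) := by
  obtain ⟨g, w, hg, hw, k⟩ := h
  refine ⟨c • g, c • w, hg.smul c, hw.smul c, fun η hη => ?_⟩
  rw [ballInt_smul, sphereInt_smul, ← k η hη]
  simp only [Pi.smul_apply, ballInt_smul, ← Finset.mul_sum]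
  ring

lemma IsBiharmonic.add {u u' : L2Ball} (h : IsBiharmonic u) (h' : IsBiharmonic u') :
    IsBiharmonic (u + u') := by
  obtain ⟨w, hw, hz⟩ := h
  obtain ⟨w', hw', hz'⟩ := h'
  exact ⟨w + w', hw.add hw', by simpa using hz.add hz'⟩

lemma IsBiharmonic.smul {u : L2Ball} (c : ℝ) (h : IsBiharmonic u) : IsBiharmonic (c • u) := by
  obtain ⟨w, hw, hz⟩ := h
  exact ⟨c • w, hw.smul c, by simpa using hz.smul c⟩

lemma HasP3b.add {u u' : L2Ball} {p p' : L2Sphere} (h : HasP3b u p) (h' : HasP3b u' p') :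
    HasP3b (u + u') (p + p') := by
  obtain ⟨w, z, t, n, hw, hz, ht, hn, k⟩ := h
  obtain ⟨w', z', t', n', hw', hz', ht', hn', k'⟩ := h'
  refine ⟨w + w', z + z', t + t', n + n', hw.add hw', hz.add hz', ht.add ht', hn.add hn',
    fun ψ hψ hν => ?_⟩
  rw [ballInt_add _ _ (continuous_lap hψ), ballInt_add _ _ hψ.continuous,
    sphereInt_add _ _ (continuousOn_sphereLap hψ), sphereInt_add _ _ (continuousOn_sphereLap hψ),
    sphereInt_add _ _ hψ.continuous.continuousOn, ← k ψ hψ hν, ← k' ψ hψ hν]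
  ring

lemma HasP3b.smul {u : L2Ball} {p : L2Sphere} (c : ℝ) (h : HasP3b u p) :
    HasP3b (c • u) (c • p) := by
  obtain ⟨w, z, t, n, hw, hz, ht, hn, k⟩ := h
  refine ⟨c • w, c • z, c • t, c • n, hw.smul c, hz.smul c, ht.smul c, hn.smul c,
    fun ψ hψ hν => ?_⟩
  rw [ballInt_smul, ballInt_smul, sphereInt_smul, sphereInt_smul, sphereInt_smul, ← k ψ hψ hν]
  ring

lemma IsSolution.add {Λ : ℝ} {u u' : L2Ball} (h : IsSolution Λ u) (h' : IsSolution Λ u') :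
    IsSolution Λ (u + u') := by
  obtain ⟨h1, h2, ⟨t, ht, h3⟩, h4⟩ := h
  obtain ⟨h1', h2', ⟨t', ht', h3'⟩, h4'⟩ := h'
  exact ⟨h1.add h1', h2.add h2', ⟨t + t', ht.add ht', by simpa [smul_add] using h3.add h3'⟩,
    by simpa using h4.add h4'⟩

lemma IsSolution.smul {Λ : ℝ} {u : L2Ball} (c : ℝ) (h : IsSolution Λ u) :
    IsSolution Λ (c • u) := by
  obtain ⟨h1, h2, ⟨t, ht, h3⟩, h4⟩ := h
  exact ⟨h1.smul c, h2.smul c, ⟨c • t, ht.smul c, by simpa [smul_comm Λ c t] using h3.smul c⟩,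
    by simpa using h4.smul c⟩

lemma ballInt_zero (f : E4 → ℝ) : ballInt 0 f = 0 := by
  simpa using ballInt_smul 0 0 f

lemma sphereInt_zero (f : E4 → ℝ) : sphereInt 0 f = 0 := by
  simpa using sphereInt_smul 0 0 f

lemma isSolution_zero (Λ : ℝ) : IsSolution Λ 0 := by
  have hg : HasWeakGrad 0 0 := fun i η _ => by simp [ballInt_zero]
  have hl : HasWeakLap 0 0 := fun η _ => by simp [ballInt_zero]
  have ht : HasTrace 0 0 := ⟨0, hg, fun i η _ => by simp [ballInt_zero, sphereInt_zero]⟩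
  have hn : HasNormalDeriv 0 0 := ⟨0, 0, hg, hl, fun η _ => by simp [ballInt_zero, sphereInt_zero]⟩
  refine ⟨⟨0, hg, fun _ => ⟨0, hg⟩⟩, ⟨0, hl, hl⟩, ⟨0, ht, 0, 0, 0, 0, hl, hl, ht, hn, ?_⟩, hn⟩
  intro ψ _ _
  simp [ballInt_zero, sphereInt_zero]

/-- The eigenspace of `Λ`: all solutions in `H²(B⁴)`, as a linear subspace of `L²(B⁴)`. -/
def eigenspace (Λ : ℝ) : Submodule ℝ L2Ball where
  carrier := {φ | IsSolution Λ φ}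
  add_mem' h h' := h.add h'
  zero_mem' := isSolution_zero Λ
  smul_mem' c _ h := h.smul c

end FlatBall

end

/-! The problem is diagonal in spherical harmonics. Let `p` be a homogeneous harmonic polynomial of
degree `k` and `φ = ½ (k + 2 - k |x|²) p`. Then `φ = p` and `∂_ν φ = 0` on the sphere, `Δ φ =
-2k(k+2) p`, and `Δ_{S³} p = -k(k+2) p`. Hence `P^{3,b} φ = (k²(k+2) + k(k+2)) p = k(k+1)(k+2) p`
(`isClassicalSolution_biharmExt`), and Green's formula turns this into a weak solution
(`IsClassicalSolution.isSolution`).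

Conversely, let `φ` be a weak solution with trace `t` and put `w = Δ φ`. For `q` harmonic of degree
`j`, Green's second identity gives `∫_B w q = -j ∫_S t q`. The weak boundary equation, tested with
the biharmonic extension of `q`, gives `-j(j+2) ∫_B w q + j(j+2) ∫_S t q = Λ ∫_S t q`. Together,
`(j(j+1)(j+2) - Λ) ∫_S t q = 0` (`IsSolution.exists_trace`). Since `j(j+1)(j+2)` is strictly
increasing, `t` is orthogonal to all degrees except at most one. By the Fischer decomposition
(`mem_fischerSpan`) and Stone–Weierstrass, harmonic polynomials are complete in `L²(S³)`
(`eq_zero_of_sphereInt_harmonic`), so `t` is zero or a spherical harmonic of that one degree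
(`exists_harmonic_of_orthogonal`). A biharmonic function is determined by its trace and normal
derivative (`eq_zero_of_biharmonic`), which identifies `φ`. The Steklov problem is settled in the
same way, with the factor `j - k` in place of `j(j+1)(j+2) - Λ`.

The uniqueness statement needs no elliptic regularity. It rests on the fact that a weakly harmonic
`L²` function orthogonal to all harmonic polynomials vanishes (`eq_zero_of_weakly_harmonic`):
testing with `(1 - |x|²)² |x|^{2m} q` yields a recurrence for the moments against `|x|^{2m} q`. The
multiplicity `(k+1)²` comes from the surjectivity of `Δ` between spaces of homogeneous polynomials
(`finrank_harmonicSubmodule`).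

Green's formulas follow from the divergence theorem on the ball (`integral_ball_partialD`), obtained
from polar coordinates and cutoffs. The symmetry of `Δ_{S³}` follows by writing it as a sum of
squares of rotation fields (`sphereLap_eq_sum_rot`). -/

namespace FlatBall

/-! ### Calculus of partial derivatives -/

lemma partialD_congr {i : Fin 4} {f g : E4 → ℝ} {x : E4} (h : f =ᶠ[nhds x] g) :
    partialD i f x = partialD i g x := by
  unfold partialD; rw [h.fderiv_eq]

lemma partialD_add {i : Fin 4} {f g : E4 → ℝ} {x : E4} (hf : DifferentiableAt ℝ f x)
    (hg : DifferentiableAt ℝ g x) :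
    partialD i (fun y => f y + g y) x = partialD i f x + partialD i g x := by
  unfold partialD; rw [fderiv_fun_add hf hg]; rfl

lemma partialD_sub {i : Fin 4} {f g : E4 → ℝ} {x : E4} (hf : DifferentiableAt ℝ f x)
    (hg : DifferentiableAt ℝ g x) :
    partialD i (fun y => f y - g y) x = partialD i f x - partialD i g x := by
  unfold partialD; rw [fderiv_fun_sub hf hg]; rfl

lemma partialD_mul {i : Fin 4} {f g : E4 → ℝ} {x : E4} (hf : DifferentiableAt ℝ f x)
    (hg : DifferentiableAt ℝ g x) :
    partialD i (fun y => f y * g y) x = f x * partialD i g x + partialD i f x * g x := by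
  unfold partialD; rw [fderiv_fun_mul hf hg]; simp [mul_comm]

lemma partialD_sum {ι : Type*} {i : Fin 4} {s : Finset ι} {f : ι → E4 → ℝ} {x : E4}
    (hf : ∀ j ∈ s, DifferentiableAt ℝ (f j) x) :
    partialD i (fun y => ∑ j ∈ s, f j y) x = ∑ j ∈ s, partialD i (f j) x := by
  unfold partialD; rw [fderiv_fun_sum hf]; simp

@[simp] lemma partialD_const (i : Fin 4) (c : ℝ) (x : E4) : partialD i (fun _ => c) x = 0 := by
  simp [partialD]

lemma partialD_coord (i j : Fin 4) (x : E4) :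
    partialD i (fun y => y j) x = if i = j then 1 else 0 := by
  unfold partialD
  have : (fun y : E4 => y j) = EuclideanSpace.proj (𝕜 := ℝ) j := rfl
  rw [this, ContinuousLinearMap.fderiv]
  simp [eq_comm]

lemma contDiff_coord (i : Fin 4) {n : WithTop ℕ∞} : ContDiff ℝ n (fun x : E4 => x i) :=
  (EuclideanSpace.proj (𝕜 := ℝ) i).contDiff

lemma contDiff_partialD (i : Fin 4) {f : E4 → ℝ} (hf : ContDiff ℝ ∞ f) :
    ContDiff ℝ ∞ (partialD i f) :=
  (hf.fderiv_right (m := ∞) (by simp)).clm_apply contDiff_const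

lemma contDiffAt_partialD (i : Fin 4) {f : E4 → ℝ} {x : E4} {n : ℕ}
    (hf : ContDiffAt ℝ (n + 1 : ℕ) f x) : ContDiffAt ℝ n (partialD i f) x :=
  (hf.fderiv_right (m := n) (by norm_cast)).clm_apply contDiffAt_const

lemma fderiv_eq_sum (f : E4 → ℝ) (x v : E4) : fderiv ℝ f x v = ∑ i, v i * partialD i f x := by
  have : v = ∑ i, v i • EuclideanSpace.single i (1 : ℝ) := by
    ext j; simp [Finset.sum_apply, Pi.single_apply]
  conv_lhs => rw [this, map_sum]
  simp [partialD]

lemma normalD_eq (f : E4 → ℝ) (x : E4) : normalD f x = ∑ i, x i * partialD i f x :=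
  fderiv_eq_sum f x x

lemma partialD_partialD {f : E4 → ℝ} {x : E4} (hf : ContDiffAt ℝ 2 f x) (i j : Fin 4) :
    partialD i (partialD j f) x =
      iteratedFDeriv ℝ 2 f x ![EuclideanSpace.single i 1, EuclideanSpace.single j 1] := by
  have hd : DifferentiableAt ℝ (fderiv ℝ f) x :=
    (hf.fderiv_right (m := 1) (by norm_num)).differentiableAt (by norm_num)
  rw [iteratedFDeriv_two_apply]
  unfold partialD
  rw [fderiv_clm_apply hd (differentiableAt_const _)]
  simp

lemma partialD_comm {f : E4 → ℝ} {x : E4} (hf : ContDiffAt ℝ 2 f x) (i j : Fin 4) :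
    partialD i (partialD j f) x = partialD j (partialD i f) x := by
  rw [partialD_partialD hf, partialD_partialD hf, iteratedFDeriv_two_apply,
    iteratedFDeriv_two_apply]
  exact hf.isSymmSndFDerivAt (by simp) _ _

lemma lap_eq_at {f : E4 → ℝ} {x : E4} (hf : ContDiffAt ℝ 2 f x) :
    lap f x = ∑ i, partialD i (partialD i f) x := by
  unfold lap
  rw [InnerProductSpace.laplacian_eq_iteratedFDeriv_orthonormalBasis f
    (EuclideanSpace.basisFun (Fin 4) ℝ)]
  refine Finset.sum_congr rfl fun i _ => ?_
  rw [partialD_partialD hf]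
  simp

lemma lap_eq {f : E4 → ℝ} (hf : ContDiff ℝ ∞ f) :
    lap f = fun x => ∑ i, partialD i (partialD i f) x := by
  funext x
  exact lap_eq_at (hf.contDiffAt.of_le (WithTop.coe_le_coe.2 le_top))

lemma contDiff_lap {f : E4 → ℝ} (hf : ContDiff ℝ ∞ f) : ContDiff ℝ ∞ (lap f) := by
  rw [lap_eq hf]
  exact ContDiff.sum fun i _ => contDiff_partialD i (contDiff_partialD i hf)

lemma contDiff_normalD {f : E4 → ℝ} (hf : ContDiff ℝ ∞ f) : ContDiff ℝ ∞ (normalD f) :=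
  (hf.fderiv_right (m := ∞) (by simp)).clm_apply contDiff_id

lemma smooth_diff {f : E4 → ℝ} (hf : ContDiff ℝ ∞ f) (x : E4) : DifferentiableAt ℝ f x :=
  (hf.differentiable (by simp)) x

lemma normalD_mul {f g : E4 → ℝ} (x : E4) (hf : DifferentiableAt ℝ f x)
    (hg : DifferentiableAt ℝ g x) :
    normalD (fun y => f y * g y) x = f x * normalD g x + normalD f x * g x := by
  simp only [normalD_eq, partialD_mul hf hg, mul_add, Finset.sum_add_distrib, Finset.mul_sum,
    Finset.sum_mul]
  congr 1 <;> exact Finset.sum_congr rfl fun i _ => by ring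

lemma lap_mul {f g : E4 → ℝ} (hf : ContDiff ℝ ∞ f) (hg : ContDiff ℝ ∞ g) (x : E4) :
    lap (fun y => f y * g y) x =
      f x * lap g x + 2 * (∑ i, partialD i f x * partialD i g x) + lap f x * g x := by
  rw [lap_eq (hf.mul hg), lap_eq hf, lap_eq hg]
  have h : ∀ i, partialD i (fun y => f y * g y) =
      fun y => f y * partialD i g y + partialD i f y * g y := fun i => by
    funext y; exact partialD_mul (smooth_diff hf y) (smooth_diff hg y)
  simp only [h]
  have h2 : ∀ i, partialD i (fun y => f y * partialD i g y + partialD i f y * g y) x =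
      f x * partialD i (partialD i g) x + 2 * (partialD i f x * partialD i g x)
        + partialD i (partialD i f) x * g x := fun i => by
    have hf' := contDiff_partialD i hf
    have hg' := contDiff_partialD i hg
    rw [partialD_add (smooth_diff (hf.mul hg') x) (smooth_diff (hf'.mul hg) x),
      partialD_mul (smooth_diff hf x) (smooth_diff hg' x),
      partialD_mul (smooth_diff hf' x) (smooth_diff hg x)]
    ring
  simp only [h2, Finset.sum_add_distrib, Finset.mul_sum, Finset.sum_mul]

/-! ### The function `|x|²` -/

/-- The squared norm as a sum of squares of coordinates. -/
lemma norm_sq_eq_sum (x : E4) : ‖x‖ ^ 2 = ∑ i, x i ^ 2 := by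
  rw [EuclideanSpace.norm_sq_eq]; simp

lemma contDiff_normSq {n : WithTop ℕ∞} : ContDiff ℝ n (fun x : E4 => ‖x‖ ^ 2) :=
  contDiff_norm_sq ℝ

/-- The argument `1 - |x|²` is the defining function of the boundary; all cutoffs below are
functions of it. -/
lemma partialD_comp_normSq {F : ℝ → ℝ} (i : Fin 4) (x : E4)
    (hF : DifferentiableAt ℝ F (1 - ‖x‖ ^ 2)) :
    partialD i (fun y => F (1 - ‖y‖ ^ 2)) x = -2 * x i * deriv F (1 - ‖x‖ ^ 2) := by
  have h1 : HasFDerivAt (fun y : E4 => 1 - ‖y‖ ^ 2) (-(2 • innerSL ℝ x)) x :=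
    (hasStrictFDerivAt_norm_sq x).hasFDerivAt.const_sub 1
  have h2 := hF.hasDerivAt.comp_hasFDerivAt x h1
  unfold partialD
  have h3 : fderiv ℝ (fun y : E4 => F (1 - ‖y‖ ^ 2)) x =
    deriv F (1 - ‖x‖ ^ 2) • (-(2 • innerSL ℝ x)) := h2.fderiv
  rw [h3]
  simp [EuclideanSpace.inner_single_right]
  ring

lemma lap_comp_normSq {F : ℝ → ℝ} (hF : ContDiff ℝ ∞ F) (x : E4) :
    lap (fun y => F (1 - ‖y‖ ^ 2)) x =
      4 * ‖x‖ ^ 2 * deriv (deriv F) (1 - ‖x‖ ^ 2) - 8 * deriv F (1 - ‖x‖ ^ 2) := by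
  have hs : ContDiff ℝ ∞ (fun y : E4 => 1 - ‖y‖ ^ 2) := contDiff_const.sub contDiff_normSq
  have hd : Differentiable ℝ F := hF.differentiable (by simp)
  have hF' : ContDiff ℝ ∞ (deriv F) := (contDiff_infty_iff_deriv.1 hF).2
  have hd' : Differentiable ℝ (deriv F) := hF'.differentiable (by simp)
  refine (congrFun (lap_eq (hF.comp hs)) x).trans ?_
  have h1 : ∀ i, partialD i (fun y : E4 => F (1 - ‖y‖ ^ 2)) =
      fun y => (-2 * y i) * deriv F (1 - ‖y‖ ^ 2) := fun i => by
    funext y; exact partialD_comp_normSq i y (hd _)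
  have h2 : ∀ i, partialD i (fun y : E4 => (-2 * y i) * deriv F (1 - ‖y‖ ^ 2)) x =
      4 * (x i ^ 2) * deriv (deriv F) (1 - ‖x‖ ^ 2) - 2 * deriv F (1 - ‖x‖ ^ 2) := fun i => by
    rw [partialD_mul (smooth_diff (contDiff_const.mul (contDiff_coord i)) x)
      (g := fun y => deriv F (1 - ‖y‖ ^ 2)) (smooth_diff (hF'.comp hs) x), partialD_comp_normSq i x (hd' _),
      partialD_mul (differentiableAt_const _) (smooth_diff (contDiff_coord i) x), partialD_coord]
    simp
    ring
  have h3 : (∑ i, partialD i (partialD i (fun y : E4 => F (1 - ‖y‖ ^ 2))) x) =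
      ∑ i, (4 * (x i ^ 2) * deriv (deriv F) (1 - ‖x‖ ^ 2) - 2 * deriv F (1 - ‖x‖ ^ 2)) :=
    Finset.sum_congr rfl fun i _ => by rw [h1, h2]
  change (∑ i, partialD i (partialD i (fun y : E4 => F (1 - ‖y‖ ^ 2))) x) = _
  rw [h3, Finset.sum_sub_distrib, ← Finset.sum_mul, ← Finset.mul_sum, ← norm_sq_eq_sum]
  simp
  ring

/-! ### Integration in polar coordinates -/

lemma integrable_ball {f : E4 → ℝ} (hf : Continuous f) : Integrable f ballMeasure :=
  (hf.continuousOn.integrableOn_compact (isCompact_closedBall (0 : E4) 1)).mono_set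
    ball_subset_closedBall

lemma integrable_sphere {f : E4 → ℝ} (hf : Continuous f) :
    Integrable (fun x : S3 => f x) sphereMeasure :=
  (hf.comp continuous_subtype_val).integrable_of_hasCompactSupport
    (HasCompactSupport.of_compactSpace _)

lemma integral_ball_eq_polar {f : E4 → ℝ} (hf : Continuous f) :
    ∫ x, f x ∂ballMeasure =
      ∫ θ : S3, (∫ r in (0 : ℝ)..1, r ^ 3 * f (r • (θ : E4))) ∂sphereMeasure := by
  -- Extending by zero allows polar coordinates on the whole punctured space; the indicator then
  -- cuts the radial integral down to `(0, 1)`.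
  set g : E4 → ℝ := (ball (0 : E4) 1).indicator f with hg
  have hgi : Integrable g volume :=
    (integrable_indicator_iff measurableSet_ball).2 (integrable_ball hf)
  have hdim : Module.finrank ℝ E4 - 1 = 3 := by simp
  have hmp := (volume : Measure E4).measurePreserving_homeomorphUnitSphereProd
  rw [hdim] at hmp
  set F : S3 × Ioi (0 : ℝ) → ℝ := fun p => g (p.2.1 • (p.1 : E4)) with hF
  have hFc : ∀ x : ({(0)}ᶜ : Set E4), F (homeomorphUnitSphereProd E4 x) = g x := fun x => by
    have hx : ‖(x : E4)‖ ≠ 0 := norm_ne_zero_iff.2 x.2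
    simp [hF, smul_smul, hx]
  have hFi : Integrable F (sphereMeasure.prod (Measure.volumeIoiPow 3)) := by
    rw [← hmp.integrable_comp_emb (Homeomorph.measurableEmbedding _)]
    have : F ∘ homeomorphUnitSphereProd E4 = g ∘ Subtype.val := funext hFc
    rw [this]
    have h2 := hgi.integrableOn (s := ({0}ᶜ : Set E4))
    exact (integrableOn_iff_comap_subtypeVal (measurableSet_singleton _).compl).1 h2
  calc ∫ x, f x ∂ballMeasure = ∫ x, g x := (integral_indicator measurableSet_ball).symm
    _ = ∫ x : ({(0)}ᶜ : Set E4), g x.1 ∂((volume : Measure E4).comap (↑)) := by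
      rw [integral_subtype_comap (measurableSet_singleton _).compl g,
        restrict_compl_singleton]
    _ = ∫ p, F p ∂(sphereMeasure.prod (Measure.volumeIoiPow 3)) := by
      rw [← hmp.integral_comp (Homeomorph.measurableEmbedding _)]
      exact integral_congr_ae (Filter.Eventually.of_forall fun x => (hFc x).symm)
    _ = ∫ θ : S3, (∫ r, F (θ, r) ∂(Measure.volumeIoiPow 3)) ∂sphereMeasure :=
      integral_prod _ hFi
    _ = _ := by
      refine integral_congr_ae (Filter.Eventually.of_forall fun θ => ?_)
      simp only [Measure.volumeIoiPow, ENNReal.ofReal]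
      have hθ : ‖(θ : E4)‖ = 1 := by simp
      rw [integral_withDensity_eq_integral_smul (by fun_prop),
        integral_subtype_comap measurableSet_Ioi
          fun a : ℝ => Real.toNNReal (a ^ 3) • g (a • (θ : E4)),
        intervalIntegral.integral_of_le zero_le_one, integral_Ioc_eq_integral_Ioo,
        ← integral_indicator measurableSet_Ioi, ← integral_indicator measurableSet_Ioo]
      refine integral_congr_ae (Filter.Eventually.of_forall fun r => ?_)
      by_cases h0 : 0 < r
      · by_cases h1 : r < 1
        · simp [hg, indicator, h0, h1, norm_smul, hθ, abs_of_pos h0, NNReal.smul_def,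
            Real.coe_toNNReal _ (pow_nonneg h0.le 3)]
        · simp [hg, indicator, h0, h1, norm_smul, hθ, abs_of_pos h0]
      · simp [indicator, h0]

/-- The divergence theorem for the radial field `x ↦ g(x) x`. -/
lemma integral_ball_radial_div {g : E4 → ℝ} (hg : ContDiff ℝ ∞ g) :
    ∫ x, (4 * g x + normalD g x) ∂ballMeasure = ∫ x : S3, g x ∂sphereMeasure := by
  refine (integral_ball_eq_polar (f := fun x => 4 * g x + normalD g x)
    ((continuous_const.mul hg.continuous).add (contDiff_normalD hg).continuous)).trans ?_
  refine integral_congr_ae (Filter.Eventually.of_forall fun θ => ?_)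
  -- The factor 4 is the dimension: with the Jacobian `r³`, the radial integrand is the exact
  -- derivative of `r⁴ g(rθ)`, whose value at `r = 1` is `g(θ)`.
  have hd : ∀ r : ℝ, HasDerivAt (fun r : ℝ => r ^ 4 * g (r • (θ : E4)))
      (r ^ 3 * (4 * g (r • (θ : E4)) + normalD g (r • (θ : E4)))) r := fun r => by
    have h1 : HasDerivAt (fun r : ℝ => r • (θ : E4)) (θ : E4) r := by
      simpa using (hasDerivAt_id r).smul_const (θ : E4)
    have h2 := (smooth_diff hg (r • (θ : E4))).hasFDerivAt.comp_hasDerivAt r h1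
    refine ((hasDerivAt_pow 4 r).mul h2).congr_deriv ?_
    simp [normalD]
    ring
  have hc : Continuous fun r : ℝ =>
      r ^ 3 * (4 * g (r • (θ : E4)) + normalD g (r • (θ : E4))) := by
    have h1 := hg.continuous
    have h2 := (contDiff_normalD hg).continuous
    fun_prop
  simp only []
  rw [intervalIntegral.integral_eq_sub_of_hasDerivAt (fun r _ => hd r) (hc.intervalIntegrable _ _)]
  simp

/-! ### Cutoff functions -/

/-- A smooth function of one variable vanishing on `s < 1` and equal to `s ^ l` for `s > 2`. -/
noncomputable def cutoff (l : ℕ) (s : ℝ) : ℝ := s ^ l * Real.smoothTransition (s - 1)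

lemma contDiff_cutoff (l : ℕ) : ContDiff ℝ ∞ (cutoff l) :=
  (contDiff_id.pow l).mul (Real.smoothTransition.contDiff.comp (contDiff_id.sub contDiff_const))

/-- `h` vanishes on `s < 1` and equals `c * s ^ l` for `s > 2`. -/
def IsCutoffPow (h : ℝ → ℝ) (c : ℝ) (l : ℕ) : Prop :=
  ContDiff ℝ ∞ h ∧ (∀ s < 1, h s = 0) ∧ ∀ s, 2 < s → h s = c * s ^ l

lemma isCutoffPow_cutoff (l : ℕ) : IsCutoffPow (cutoff l) 1 l := by
  refine ⟨contDiff_cutoff l, fun s hs => ?_, fun s hs => ?_⟩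
  · simp [cutoff, Real.smoothTransition.zero_of_nonpos (show s - 1 ≤ 0 by linarith)]
  · simp [cutoff, Real.smoothTransition.one_of_one_le (show 1 ≤ s - 1 by linarith)]

lemma IsCutoffPow.deriv {h : ℝ → ℝ} {c : ℝ} {l : ℕ} (hh : IsCutoffPow h c (l + 1)) :
    IsCutoffPow (deriv h) (c * (l + 1)) l := by
  obtain ⟨h1, h2, h3⟩ := hh
  refine ⟨(contDiff_infty_iff_deriv.1 h1).2, fun s hs => ?_, fun s hs => ?_⟩
  · have : h =ᶠ[nhds s] fun _ => 0 := by
      filter_upwards [Iio_mem_nhds hs] with t ht using h2 t ht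
    rw [this.deriv_eq]; simp
  · have : h =ᶠ[nhds s] fun t => c * t ^ (l + 1) := by
      filter_upwards [Ioi_mem_nhds hs] with t ht using h3 t ht
    rw [this.deriv_eq]; simp; ring

/-- The rescaled function `s ↦ h ((n + 1) s) / (n + 1) ^ l`. -/
noncomputable def rescale (h : ℝ → ℝ) (l n : ℕ) (s : ℝ) : ℝ := h ((n + 1) * s) / (n + 1) ^ l

lemma contDiff_rescale {h : ℝ → ℝ} (hh : ContDiff ℝ ∞ h) (l n : ℕ) :
    ContDiff ℝ ∞ (rescale h l n) :=
  (hh.comp (contDiff_const.mul contDiff_id)).div_const _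

/-- The factor `n + 1` from the chain rule lowers the normalising power by one. Derivatives of
rescaled cutoffs are therefore rescaled cutoffs again, and up to order `l` they stay bounded
uniformly in `n`. -/
lemma deriv_rescale {h : ℝ → ℝ} (hh : ContDiff ℝ ∞ h) (l n : ℕ) :
    deriv (rescale h (l + 1) n) = rescale (deriv h) l n := by
  funext s
  have h0 : (n + 1 : ℝ) ≠ 0 := by positivity
  have h1 : HasDerivAt (fun s : ℝ => (n + 1 : ℝ) * s) (n + 1) s := by
    simpa using (hasDerivAt_id s).const_mul (n + 1 : ℝ)
  have h2 := ((hh.differentiable (by simp) _).hasDerivAt.comp s h1).div_const ((n + 1 : ℝ) ^ (l + 1))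
  rw [show rescale h (l + 1) n = fun s => (h ∘ fun s : ℝ => (n + 1 : ℝ) * s) s / (n + 1) ^ (l + 1)
    from rfl, h2.deriv]
  unfold rescale
  rw [pow_succ]
  field_simp

lemma IsCutoffPow.bounded {h : ℝ → ℝ} {c : ℝ} {l : ℕ} (hh : IsCutoffPow h c l) :
    ∃ C, ∀ n : ℕ, ∀ s, 0 ≤ s → s ≤ 1 → |rescale h l n s| ≤ C := by
  obtain ⟨h1, h2, h3⟩ := hh
  obtain ⟨M, hM⟩ := (isCompact_Icc (a := (1 : ℝ)) (b := 2)).exists_bound_of_continuousOn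
    h1.continuous.continuousOn
  have hM0 : 0 ≤ M := (norm_nonneg _).trans (hM 1 (by simp))
  -- A bound homogeneous of degree `l` is invariant under the rescaling, hence uniform in `n`. Only
  -- `[1, 2]` needs compactness: `h` is zero before it and an exact power after it.
  have key : ∀ s, 0 ≤ s → |h s| ≤ (M + |c|) * s ^ l := fun s hs => by
    rcases lt_or_ge s 1 with hs1 | hs1
    · rw [h2 s hs1]; simp; positivity
    · have hp : 1 ≤ s ^ l := one_le_pow₀ hs1
      rcases le_or_gt s 2 with hs2 | hs2
      · have := hM s ⟨hs1, hs2⟩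
        rw [Real.norm_eq_abs] at this
        nlinarith [abs_nonneg c]
      · rw [h3 s hs2, abs_mul, abs_of_nonneg (pow_nonneg hs l)]
        nlinarith [abs_nonneg c]
  refine ⟨M + |c|, fun n s hs hs1 => ?_⟩
  have hn : (0 : ℝ) < (n + 1) ^ l := by positivity
  unfold rescale
  rw [abs_div, abs_of_pos hn, div_le_iff₀ hn]
  refine (key _ (by positivity)).trans ?_
  rw [mul_pow]
  have : s ^ l ≤ 1 := pow_le_one₀ hs hs1
  have h4 : (n + 1 : ℝ) ^ l * s ^ l ≤ (n + 1) ^ l := by nlinarith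
  exact mul_le_mul_of_nonneg_left h4 (by positivity)

/-- The sequence is eventually constant, namely once `(n + 1) s > 2`. -/
lemma IsCutoffPow.tendsto {h : ℝ → ℝ} {c : ℝ} {l : ℕ} (hh : IsCutoffPow h c l) {s : ℝ}
    (hs : 0 < s) :
    Filter.Tendsto (fun n => rescale h l n s) Filter.atTop (nhds (c * s ^ l)) := by
  refine tendsto_const_nhds.congr' ?_
  obtain ⟨N, hN⟩ := exists_nat_gt (2 / s)
  filter_upwards [Filter.eventually_ge_atTop N] with n hn
  have h1 : 2 < (n + 1 : ℝ) * s := by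
    rw [div_lt_iff₀ hs] at hN
    have : (N : ℝ) ≤ n := by exact_mod_cast hn
    nlinarith
  unfold rescale
  rw [hh.2.2 _ h1, mul_pow]
  field_simp

lemma isTest_of_eq_zero {f : E4 → ℝ} (hf : ContDiff ℝ ∞ f) {r : ℝ} (hr : r < 1)
    (h : ∀ x, r < ‖x‖ ^ 2 → f x = 0) : IsTest f := by
  have hsub : tsupport f ⊆ {x : E4 | ‖x‖ ^ 2 ≤ r} := by
    refine closure_minimal (fun x hx => ?_) (isClosed_le (by fun_prop) continuous_const)
    by_contra hx'
    exact hx (h x (not_le.1 hx'))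
  have hball : tsupport f ⊆ ball (0 : E4) 1 := fun x hx => by
    have := hsub hx
    simp only [mem_ofPred_eq, mem_ball_zero_iff] at *
    nlinarith [norm_nonneg x]
  exact ⟨hf, (isCompact_closedBall (0 : E4) 1).of_isClosed_subset (isClosed_tsupport _)
    (hball.trans ball_subset_closedBall), hball⟩

lemma isTest_rescale_mul {h : ℝ → ℝ} {c : ℝ} {k : ℕ} (hh : IsCutoffPow h c k) (l n : ℕ)
    {f : E4 → ℝ} (hf : ContDiff ℝ ∞ f) :
    IsTest fun x => rescale h l n (1 - ‖x‖ ^ 2) * f x := by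
  have hn : (0 : ℝ) < n + 1 := by positivity
  refine isTest_of_eq_zero (((contDiff_rescale hh.1 l n).comp
    (contDiff_const.sub contDiff_normSq)).mul hf) (r := 1 - 1 / (n + 1)) ?_ fun x hx => ?_
  · have : (0 : ℝ) < 1 / (n + 1) := by positivity
    linarith
  · have h1 : (n + 1 : ℝ) * (1 - ‖x‖ ^ 2) < 1 := by
      have : (1 - ‖x‖ ^ 2) < 1 / (n + 1) := by linarith
      rw [lt_div_iff₀ hn] at this
      linarith
    simp [rescale, hh.2.1 _ h1]

lemma integral_ball_partialD_test {η : E4 → ℝ} (hη : IsTest η) (i : Fin 4) :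
    ∫ x, partialD i η x ∂ballMeasure = 0 := by
  have hc : HasCompactSupport (partialD i η) := hη.2.1.fderiv_apply ℝ _
  have hcont := continuous_partialD i hη.1
  have h1 : ∫ x, partialD i η x ∂ballMeasure = ∫ x, partialD i η x := by
    refine setIntegral_eq_integral_of_forall_compl_eq_zero fun x hx => ?_
    have : x ∉ tsupport η := fun h => hx (hη.2.2 h)
    rw [notMem_tsupport_iff_eventuallyEq] at this
    rw [partialD_congr this]
    exact partialD_const i 0 x
  have h2 := integral_mul_fderiv_eq_neg_fderiv_mul_of_integrable (μ := (volume : Measure E4))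
    (f := fun _ => (1 : ℝ)) (g := η) (v := EuclideanSpace.single i (1 : ℝ)) (by simp)
    (by simpa using! hcont.integrable_of_hasCompactSupport hc)
    (by simpa using hη.1.continuous.integrable_of_hasCompactSupport hη.2.1)
    (fun x _ => differentiableAt_const _) (fun x _ => smooth_diff hη.1 x)
  rw [h1]
  simpa [partialD] using h2

lemma abs_coord_le (x : E4) (i : Fin 4) : |x i| ≤ ‖x‖ := by
  simpa using EuclideanSpace.norm_eq x ▸ PiLp.norm_apply_le x i

/-! ### The divergence theorem on the ball -/

/-- The factor `1 - |x|²` is replaced by cutoffs that vanish near the sphere, for which the integral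
is zero. The factor vanishes to first order at the sphere, so the gradients of the cutoffs stay
bounded and dominated convergence applies. -/
lemma integral_ball_partialD_of_vanishing {h : E4 → ℝ} (hh : ContDiff ℝ ∞ h) (i : Fin 4) :
    ∫ x, partialD i (fun y => (1 - ‖y‖ ^ 2) * h y) x ∂ballMeasure = 0 := by
  have hK := isCutoffPow_cutoff 1
  have hK' := hK.deriv (l := 0)
  obtain ⟨C, hC⟩ := hK.bounded
  obtain ⟨C', hC'⟩ := hK'.bounded
  have hs : ContDiff ℝ ∞ (fun y : E4 => 1 - ‖y‖ ^ 2) := contDiff_const.sub contDiff_normSq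
  set G : ℕ → E4 → ℝ := fun n x => rescale (cutoff 1) 1 n (1 - ‖x‖ ^ 2) * partialD i h x +
    -2 * x i * rescale (deriv (cutoff 1)) 0 n (1 - ‖x‖ ^ 2) * h x with hG
  have hGe : ∀ n, (fun x => partialD i (fun y => rescale (cutoff 1) 1 n (1 - ‖y‖ ^ 2) * h y) x) =
      G n := fun n => by
    funext x
    have hr := contDiff_rescale hK.1 1 n
    rw [partialD_mul (f := fun y => rescale (cutoff 1) 1 n (1 - ‖y‖ ^ 2))
      (smooth_diff (hr.comp hs) x) (smooth_diff hh x),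
      partialD_comp_normSq i x (hr.differentiable (by simp) _), deriv_rescale hK.1 0 n]
  have hGc : ∀ n, Continuous (G n) := fun n => by
    rw [← hGe n]
    exact continuous_partialD i (isTest_rescale_mul hK 1 n hh).1
  have hlim := tendsto_integral_of_dominated_convergence (μ := ballMeasure) (F := G)
    (f := fun x => partialD i (fun y => (1 - ‖y‖ ^ 2) * h y) x)
    (fun x => C * |partialD i h x| + 2 * C' * |h x|)
    (fun n => (hGc n).aestronglyMeasurable)
    (integrable_ball ((continuous_const.mul (continuous_partialD i hh).abs).add
      (continuous_const.mul hh.continuous.abs)))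
    (fun n => by
      filter_upwards [ae_restrict_mem measurableSet_ball] with x hx
      have hx1 : ‖x‖ < 1 := by simpa using hx
      have hx0 := norm_nonneg x
      have ha : 0 ≤ 1 - ‖x‖ ^ 2 := by nlinarith
      have hb : 1 - ‖x‖ ^ 2 ≤ 1 := by nlinarith
      have h1 := hC n _ ha hb
      have h2 := hC' n _ ha hb
      have h3 := (abs_coord_le x i).trans hx1.le
      refine (abs_add_le _ _).trans (add_le_add ?_ ?_)
      · rw [abs_mul]; gcongr
      · rw [abs_mul, abs_mul, abs_mul]
        have : |x i| * |rescale (deriv (cutoff 1)) 0 n (1 - ‖x‖ ^ 2)| ≤ 1 * C' :=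
          mul_le_mul h3 h2 (abs_nonneg _) zero_le_one
        have h4 : |(-2 : ℝ)| = 2 := by norm_num
        rw [h4]
        refine mul_le_mul_of_nonneg_right ?_ (abs_nonneg _)
        linarith)
    (by
      filter_upwards [ae_restrict_mem measurableSet_ball] with x hx
      have hx1 : ‖x‖ < 1 := by simpa using hx
      have hpos : 0 < 1 - ‖x‖ ^ 2 := by nlinarith [norm_nonneg x]
      have h1 := (hK.tendsto hpos).mul_const (partialD i h x)
      have h2 := ((hK'.tendsto hpos).const_mul (-2 * x i)).mul_const (h x)
      have h3 := h1.add h2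
      convert h3 using 2
      rw [partialD_mul (smooth_diff hs x) (smooth_diff hh x)]
      have := partialD_comp_normSq (F := fun s => s) i x differentiableAt_id
      rw [this]
      simp)
  have hz : ∀ n, ∫ x, G n x ∂ballMeasure = 0 := fun n => by
    rw [← hGe n]; exact integral_ball_partialD_test (isTest_rescale_mul hK 1 n hh) i
  simp only [hz] at hlim
  exact (tendsto_nhds_unique hlim tendsto_const_nhds)

/-- The divergence theorem on the unit ball. -/
lemma integral_ball_partialD {f : E4 → ℝ} (hf : ContDiff ℝ ∞ f) (i : Fin 4) :
    ∫ x, partialD i f x ∂ballMeasure = ∫ x : S3, f x * (x : E4) i ∂sphereMeasure := by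
  have hc : ∀ j, ContDiff ℝ ∞ fun x : E4 => x j := fun j => contDiff_coord j
  have hfi : ContDiff ℝ ∞ fun x : E4 => f x * x i := hf.mul (hc i)
  rw [← integral_ball_radial_div hfi]
  set k : Fin 4 → E4 → ℝ := fun j x => x j * f x with hk
  have hks : ∀ j, ContDiff ℝ ∞ (k j) := fun j => (hc j).mul hf
  have hs : ContDiff ℝ ∞ (fun y : E4 => 1 - ‖y‖ ^ 2) := contDiff_const.sub contDiff_normSq
  have hv : ∀ h : E4 → ℝ, ContDiff ℝ ∞ h → ∀ j, ∀ x,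
      partialD j (fun y => (1 - ‖y‖ ^ 2) * h y) x =
        (1 - ‖x‖ ^ 2) * partialD j h x - 2 * x j * h x := fun h hh j x => by
    rw [partialD_mul (smooth_diff hs x) (smooth_diff hh x),
      partialD_comp_normSq (F := fun s => s) j x differentiableAt_id]
    simp
    ring
  -- The middle term is the divergence of the radial field `f x_i x`, whose flux is `f x_i`. The
  -- remaining vector field `f e_i - f x_i x` is tangential on the sphere, and its divergence is a
  -- combination of derivatives of functions containing the factor `1 - |x|²`, which integrate to
  -- zero.
  have key : ∀ x, partialD i f x = partialD i (fun y => (1 - ‖y‖ ^ 2) * f y) x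
      + (4 * (f x * x i) + normalD (fun x : E4 => f x * x i) x)
      + ∑ j, (-(1 / 2) * partialD j (fun y => (1 - ‖y‖ ^ 2) * partialD i (k j) y) x
        + (1 / 2) * partialD i (fun y => (1 - ‖y‖ ^ 2) * partialD j (k j) y) x) := fun x => by
    have hkd : ∀ l j, partialD l (k j) x = x j * partialD l f x + (if l = j then 1 else 0) * f x :=
      fun l j => by
        rw [hk, partialD_mul (smooth_diff (hc j) x) (smooth_diff hf x), partialD_coord]
    rw [normalD_mul x (smooth_diff hf x) (smooth_diff (hc i) x), hv f hf]
    -- The second derivatives of `k j` cancel by symmetry. Only the derivatives of `1 - |x|²`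
    -- remain, and they assemble into the rotation `x_j ∂_i - x_i ∂_j` applied to `x_j f`.
    have hterm : ∀ j, -(1 / 2) * partialD j (fun y => (1 - ‖y‖ ^ 2) * partialD i (k j) y) x
        + (1 / 2) * partialD i (fun y => (1 - ‖y‖ ^ 2) * partialD j (k j) y) x =
        x j * (x j * partialD i f x + (if i = j then 1 else 0) * f x)
          - x i * (x j * partialD j f x + f x) := fun j => by
      rw [hv _ (contDiff_partialD _ (hks _)), hv _ (contDiff_partialD _ (hks _)),
        partialD_comm ((hks j).contDiffAt.of_le (WithTop.coe_le_coe.2 le_top)) j i, hkd, hkd]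
      simp
      ring
    rw [Finset.sum_congr rfl fun j _ => hterm j, norm_sq_eq_sum, normalD_eq, normalD_eq]
    simp only [partialD_coord, Fin.sum_univ_four]
    fin_cases i <;> simp <;> ring
  rw [integral_congr_ae (Filter.Eventually.of_forall key)]
  have hvi : ∀ h : E4 → ℝ, ContDiff ℝ ∞ h → ∀ j,
      Integrable (fun x => partialD j (fun y => (1 - ‖y‖ ^ 2) * h y) x) ballMeasure :=
    fun h hh j => integrable_ball (continuous_partialD j (hs.mul hh))
  have hi1 := hvi f hf i
  have hi2 : Integrable (fun x : E4 => 4 * (f x * x i) + normalD (fun x : E4 => f x * x i) x)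
      ballMeasure := integrable_ball ((continuous_const.mul hfi.continuous).add
        (contDiff_normalD hfi).continuous)
  have hi3 : ∀ j, Integrable (fun x => -(1 / 2) *
      partialD j (fun y => (1 - ‖y‖ ^ 2) * partialD i (k j) y) x) ballMeasure :=
    fun j => (hvi _ (contDiff_partialD i (hks j)) j).const_mul _
  have hi4 : ∀ j, Integrable (fun x => (1 / 2) *
      partialD i (fun y => (1 - ‖y‖ ^ 2) * partialD j (k j) y) x) ballMeasure :=
    fun j => (hvi _ (contDiff_partialD j (hks j)) i).const_mul _
  have hi34 := fun j => (hi3 j).fun_add (hi4 j)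
  rw [integral_add (hi1.fun_add hi2) (integrable_finsetSum _ fun j _ => hi34 j),
    integral_add hi1 hi2, integral_finsetSum _ (fun j _ => hi34 j),
    integral_ball_partialD_of_vanishing hf]
  have hz : ∀ j, ∫ x, (-(1 / 2) * partialD j (fun y => (1 - ‖y‖ ^ 2) * partialD i (k j) y) x
        + (1 / 2) * partialD i (fun y => (1 - ‖y‖ ^ 2) * partialD j (k j) y) x) ∂ballMeasure = 0 :=
    fun j => by
      rw [integral_add (hi3 j) (hi4 j), integral_const_mul, integral_const_mul,
        integral_ball_partialD_of_vanishing (contDiff_partialD i (hks j)),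
        integral_ball_partialD_of_vanishing (contDiff_partialD j (hks j))]
      simp
  simp only [hz, Finset.sum_const_zero, zero_add, add_zero]

/-! ### Rotation fields and the Laplace–Beltrami operator of the sphere -/

lemma smooth_at_two {f : E4 → ℝ} (hf : ContDiff ℝ ∞ f) (x : E4) : ContDiffAt ℝ 2 f x :=
  hf.contDiffAt.of_le (WithTop.coe_le_coe.2 le_top)

/-- The derivative along the rotation field `x_i ∂_j - x_j ∂_i`. -/
noncomputable def rot (i j : Fin 4) (f : E4 → ℝ) (x : E4) : ℝ :=
  x i * partialD j f x - x j * partialD i f x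

lemma contDiff_rot (i j : Fin 4) {f : E4 → ℝ} (hf : ContDiff ℝ ∞ f) : ContDiff ℝ ∞ (rot i j f) :=
  ((contDiff_coord i).mul (contDiff_partialD j hf)).sub
    ((contDiff_coord j).mul (contDiff_partialD i hf))

lemma rot_congr {i j : Fin 4} {f g : E4 → ℝ} {x : E4} (h : f =ᶠ[nhds x] g) :
    rot i j f x = rot i j g x := by
  simp only [rot, partialD_congr h]

lemma rot_mul (i j : Fin 4) {f g : E4 → ℝ} (hf : ContDiff ℝ ∞ f) (hg : ContDiff ℝ ∞ g) (x : E4) :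
    rot i j (fun y => f y * g y) x = f x * rot i j g x + rot i j f x * g x := by
  simp only [rot, partialD_mul (smooth_diff hf x) (smooth_diff hg x)]
  ring

/-- By the divergence theorem the integral equals `∫_B (∂_i ∂_j f - ∂_j ∂_i f)`. With the product
rule it makes each rotation field skew-symmetric on `L²(S³)`. -/
lemma integral_sphere_rot (i j : Fin 4) {f : E4 → ℝ} (hf : ContDiff ℝ ∞ f) :
    ∫ x : S3, rot i j f x ∂sphereMeasure = 0 := by
  have h : ∀ i j, Integrable (fun x : S3 => partialD j f x * (x : E4) i) sphereMeasure :=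
    fun i j => integrable_sphere (f := fun x => partialD j f x * x i)
      ((continuous_partialD j hf).mul (contDiff_coord i (n := 0)).continuous)
  have : ∀ x : S3, rot i j f x = partialD j f x * (x : E4) i - partialD i f x * (x : E4) j :=
    fun x => by simp only [rot]; ring
  simp only [this]
  rw [integral_sub (h i j) (h j i), ← integral_ball_partialD (contDiff_partialD j hf) i,
    ← integral_ball_partialD (contDiff_partialD i hf) j]
  simp only [partialD_comm (smooth_at_two hf _) i j, sub_self]

lemma integral_sphere_mul_rot (i j : Fin 4) {f g : E4 → ℝ} (hf : ContDiff ℝ ∞ f)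
    (hg : ContDiff ℝ ∞ g) :
    ∫ x : S3, f x * rot i j g x ∂sphereMeasure = -∫ x : S3, rot i j f x * g x ∂sphereMeasure := by
  have h := integral_sphere_rot i j (hf.mul hg)
  simp only [rot_mul i j hf hg] at h
  rw [integral_add (integrable_sphere (f := fun x => f x * rot i j g x)
    (hf.mul (contDiff_rot i j hg)).continuous)
    (integrable_sphere (f := fun x => rot i j f x * g x)
    ((contDiff_rot i j hf).mul hg).continuous)] at h
  linarith

lemma normalD_normalD {f : E4 → ℝ} {x : E4} (hf : ContDiffAt ℝ 2 f x) :
    normalD (normalD f) x =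
      ∑ i, x i * (partialD i f x + ∑ j, x j * partialD i (partialD j f) x) := by
  have hd : ∀ j, DifferentiableAt ℝ (partialD j f) x := fun j =>
    (contDiffAt_partialD (n := 1) j hf).differentiableAt (by norm_num)
  have hc : ∀ j, DifferentiableAt ℝ (fun y : E4 => y j) x :=
    fun j => smooth_diff (contDiff_coord j) x
  rw [normalD_eq]
  refine Finset.sum_congr rfl fun i _ => ?_
  have h1 : normalD f = fun y => ∑ j, y j * partialD j f y := funext (normalD_eq f)
  rw [h1, partialD_sum (fun j _ => (hc j).fun_mul (hd j))]
  congr 1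
  simp only [partialD_mul (hc _) (hd _), partialD_coord, Finset.sum_add_distrib]
  simp [add_comm]

/-- This is the splitting of the Laplacian into radial and angular parts; the inner coefficient 2 is
the dimension minus two. The outer factor 2 arises because each unordered pair is counted twice.
Smoothness is assumed only at the point, since extensions constant along rays are singular at the
origin. -/
lemma sum_rot_rot {f : E4 → ℝ} {x : E4} (hf : ContDiffAt ℝ 2 f x) :
    ∑ i, ∑ j, rot i j (rot i j f) x =
      2 * (‖x‖ ^ 2 * lap f x - normalD (normalD f) x - 2 * normalD f x) := by
  have hd : ∀ j, DifferentiableAt ℝ (partialD j f) x := fun j =>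
    (contDiffAt_partialD (n := 1) j hf).differentiableAt (by norm_num)
  have hc : ∀ j, DifferentiableAt ℝ (fun y : E4 => y j) x :=
    fun j => smooth_diff (contDiff_coord j) x
  have h1 : ∀ i j k, partialD k (rot i j f) x =
      x i * partialD k (partialD j f) x + (if k = i then 1 else 0) * partialD j f x -
      (x j * partialD k (partialD i f) x + (if k = j then 1 else 0) * partialD i f x) :=
    fun i j k => by
      have : rot i j f = fun y => y i * partialD j f y - y j * partialD i f y := rfl
      rw [this, partialD_sub ((hc i).fun_mul (hd j)) ((hc j).fun_mul (hd i)), partialD_mul (hc i) (hd j),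
        partialD_mul (hc j) (hd i), partialD_coord, partialD_coord]
  rw [normalD_normalD hf, normalD_eq, lap_eq_at hf, norm_sq_eq_sum]
  have h2 : ∀ i j, rot i j (rot i j f) x = x i * partialD j (rot i j f) x -
    x j * partialD i (rot i j f) x := fun i j => rfl
  simp only [h2, h1]
  simp only [Fin.sum_univ_four]
  simp
  rw [partialD_comm hf 1 0, partialD_comm hf 2 0, partialD_comm hf 3 0, partialD_comm hf 2 1,
    partialD_comm hf 3 1, partialD_comm hf 3 2]
  ring

/-- The extension of `f|_{S³}` that is constant along rays. -/
noncomputable def radialExt (f : E4 → ℝ) (y : E4) : ℝ := f (‖y‖⁻¹ • y)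

lemma hasFDerivAt_normalize {y : E4} (hy : y ≠ 0) :
    HasFDerivAt (fun y : E4 => ‖y‖⁻¹ • y)
      (‖y‖⁻¹ • ContinuousLinearMap.id ℝ E4 - (‖y‖⁻¹ ^ 3 • innerSL ℝ y).smulRight y) y := by
  have h0 : ‖y‖ ≠ 0 := norm_ne_zero_iff.2 hy
  have h1 : HasFDerivAt (fun y : E4 => ‖y‖ ^ 2) (2 • innerSL ℝ y) y :=
    (hasStrictFDerivAt_norm_sq y).hasFDerivAt
  have h2 := ((Real.hasDerivAt_sqrt (pow_ne_zero 2 h0)).inv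
    (by rw [Real.sqrt_sq (norm_nonneg y)]; exact h0)).comp_hasFDerivAt y h1
  have h3 : ((Real.sqrt)⁻¹ ∘ fun y : E4 => ‖y‖ ^ 2) = fun y : E4 => ‖y‖⁻¹ := by
    funext z; simp [Real.sqrt_sq (norm_nonneg z)]
  rw [h3] at h2
  refine (h2.smul (hasFDerivAt_id y)).congr_fderiv ?_
  ext v k
  simp [Real.sqrt_sq (norm_nonneg y)]
  field_simp
  ring

lemma contDiffAt_radialExt {f : E4 → ℝ} (hf : ContDiff ℝ ∞ f) {y : E4} (hy : y ≠ 0) :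
    ContDiffAt ℝ 2 (radialExt f) y :=
  ContDiffAt.comp y (smooth_at_two hf _)
    (((contDiffAt_norm ℝ hy).inv (norm_ne_zero_iff.mpr hy)).smul contDiffAt_id)

lemma fderiv_radialExt {f : E4 → ℝ} (hf : ContDiff ℝ ∞ f) {y : E4} (hy : y ≠ 0) (v : E4) :
    fderiv ℝ (radialExt f) y v =
      fderiv ℝ f (‖y‖⁻¹ • y) (‖y‖⁻¹ • v - (‖y‖⁻¹ ^ 3 * inner ℝ y v) • y) := by
  have h := HasFDerivAt.comp (f := fun y : E4 => ‖y‖⁻¹ • y) y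
    (smooth_diff hf (‖y‖⁻¹ • y)).hasFDerivAt (hasFDerivAt_normalize hy)
  have h2 : fderiv ℝ (radialExt f) y = _ := h.fderiv
  rw [h2]
  simp

lemma normalD_radialExt {f : E4 → ℝ} (hf : ContDiff ℝ ∞ f) {y : E4} (hy : y ≠ 0) :
    normalD (radialExt f) y = 0 := by
  have h0 : ‖y‖ ≠ 0 := norm_ne_zero_iff.2 hy
  unfold normalD
  rw [fderiv_radialExt hf hy, real_inner_self_eq_norm_sq]
  have : ‖y‖⁻¹ ^ 3 * ‖y‖ ^ 2 = ‖y‖⁻¹ := by field_simp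
  rw [this, sub_self, map_zero]

lemma rot_eq_fderiv (i j : Fin 4) (f : E4 → ℝ) (x : E4) :
    rot i j f x = fderiv ℝ f x
      (x i • EuclideanSpace.single j (1 : ℝ) - x j • EuclideanSpace.single i (1 : ℝ)) := by
  simp [rot, partialD]

/-- Rotation fields are tangent to spheres and linear in `y`, so they commute with the normalisation
`y ↦ y / |y|`. -/
lemma rot_radialExt (i j : Fin 4) {f : E4 → ℝ} (hf : ContDiff ℝ ∞ f) {y : E4} (hy : y ≠ 0) :
    rot i j (radialExt f) y = radialExt (rot i j f) y := by
  rw [rot_eq_fderiv, fderiv_radialExt hf hy]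
  unfold radialExt
  rw [rot_eq_fderiv]
  congr 1
  have : inner ℝ y (y i • EuclideanSpace.single j (1 : ℝ) - y j • EuclideanSpace.single i (1 : ℝ))
      = 0 := by
    simp [inner_sub_right, inner_smul_right, EuclideanSpace.inner_single_right]
    ring
  rw [this]
  simp [smul_sub, smul_smul]

lemma ne_zero_of_mem_sphere {x : E4} (hx : x ∈ sphere (0 : E4) 1) : x ≠ 0 := by
  rintro rfl; simp at hx

/-- For the extension constant along rays the radial terms in `sum_rot_rot` vanish, leaving twice
its Laplacian. The rotation fields commute with forming this extension, so they may be applied to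
`f` itself. -/
lemma sphereLap_eq_sum_rot {f : E4 → ℝ} (hf : ContDiff ℝ ∞ f) {x : E4}
    (hx : x ∈ sphere (0 : E4) 1) :
    sphereLap f x = (1 / 2) * ∑ i, ∑ j, rot i j (rot i j f) x := by
  have hx0 := ne_zero_of_mem_sphere hx
  have hx1 : ‖x‖ = 1 := by simpa using hx
  have h1 := sum_rot_rot (contDiffAt_radialExt hf hx0)
  have hne : ∀ᶠ y in nhds x, y ≠ 0 := isOpen_ne.mem_nhds hx0
  have h2 : normalD (radialExt f) =ᶠ[nhds x] fun _ => 0 := by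
    filter_upwards [hne] with y hy using normalD_radialExt hf hy
  have h3 : normalD (normalD (radialExt f)) x = 0 := by
    unfold normalD at h2 ⊢
    rw [h2.fderiv_eq]; simp
  have h4 : ∀ i j, rot i j (rot i j (radialExt f)) x = rot i j (rot i j f) x := fun i j => by
    have h5 : rot i j (radialExt f) =ᶠ[nhds x] radialExt (rot i j f) := by
      filter_upwards [hne] with y hy using rot_radialExt i j hf hy
    rw [rot_congr h5, rot_radialExt i j (contDiff_rot i j hf) hx0]
    simp [radialExt, hx1]
  simp only [h4, h3, normalD_radialExt hf hx0, hx1] at h1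
  have h6 : sphereLap f x = lap (radialExt f) x := rfl
  rw [h6, h1]
  ring

lemma sphereLap_eq {f : E4 → ℝ} (hf : ContDiff ℝ ∞ f) {x : E4} (hx : x ∈ sphere (0 : E4) 1) :
    sphereLap f x = lap f x - normalD (normalD f) x - 2 * normalD f x := by
  have hx1 : ‖x‖ = 1 := by simpa using hx
  rw [sphereLap_eq_sum_rot hf hx, sum_rot_rot (smooth_at_two hf x), hx1]
  ring

lemma sphereLap_congr {f g : E4 → ℝ} (h : ∀ x ∈ sphere (0 : E4) 1, f x = g x) {x : E4}
    (hx : x ∈ sphere (0 : E4) 1) : sphereLap f x = sphereLap g x := by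
  have hx0 := ne_zero_of_mem_sphere hx
  have : (fun y : E4 => f (‖y‖⁻¹ • y)) =ᶠ[nhds x] fun y => g (‖y‖⁻¹ • y) := by
    filter_upwards [isOpen_ne.mem_nhds hx0] with y hy
    exact h _ (by simp [norm_smul, norm_ne_zero_iff.2 hy])
  exact (InnerProductSpace.laplacian_congr_nhds this).eq_of_nhds

lemma sphereLap_eq_zero {f : E4 → ℝ} (h : ∀ x ∈ sphere (0 : E4) 1, f x = 0) {x : E4}
    (hx : x ∈ sphere (0 : E4) 1) : sphereLap f x = 0 := by
  rw [sphereLap_congr (g := fun _ => 0) h hx, sphereLap_eq contDiff_const hx,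
    lap_eq contDiff_const]
  have h0 : ∀ i, partialD i (fun _ : E4 => (0 : ℝ)) = fun _ => 0 :=
    fun i => funext (partialD_const i 0)
  have h1 : normalD (fun _ : E4 => (0 : ℝ)) = fun _ => 0 := by funext y; simp [normalD]
  simp [h0, h1]

/-- A sum of squares of skew-symmetric operators is symmetric. -/
lemma integral_sphere_sphereLap {f g : E4 → ℝ} (hf : ContDiff ℝ ∞ f) (hg : ContDiff ℝ ∞ g) :
    ∫ x : S3, f x * sphereLap g x ∂sphereMeasure = ∫ x : S3, sphereLap f x * g x ∂sphereMeasure := by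
  have h1 : ∀ x : S3, f x * sphereLap g x =
      (1 / 2) * ∑ i, ∑ j, f x * rot i j (rot i j g) x := fun x => by
    rw [sphereLap_eq_sum_rot hg x.2]; simp only [Finset.mul_sum]
    exact Finset.sum_congr rfl fun i _ => Finset.sum_congr rfl fun j _ => by ring
  have h2 : ∀ x : S3, sphereLap f x * g x =
      (1 / 2) * ∑ i, ∑ j, rot i j (rot i j f) x * g x := fun x => by
    rw [sphereLap_eq_sum_rot hf x.2]; simp only [Finset.mul_sum, Finset.sum_mul]
    exact Finset.sum_congr rfl fun i _ => Finset.sum_congr rfl fun j _ => by ring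
  have i1 : ∀ i j, Integrable (fun x : S3 => f x * rot i j (rot i j g) x) sphereMeasure :=
    fun i j => integrable_sphere (f := fun x => f x * rot i j (rot i j g) x)
      (hf.mul (contDiff_rot i j (contDiff_rot i j hg))).continuous
  have i2 : ∀ i j, Integrable (fun x : S3 => rot i j (rot i j f) x * g x) sphereMeasure :=
    fun i j => integrable_sphere (f := fun x => rot i j (rot i j f) x * g x)
      ((contDiff_rot i j (contDiff_rot i j hf)).mul hg).continuous
  simp only [h1, h2, integral_const_mul]
  rw [integral_finsetSum _ fun i _ => integrable_finsetSum _ fun j _ => i1 i j,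
    integral_finsetSum _ fun i _ => integrable_finsetSum _ fun j _ => i2 i j]
  congr 1
  refine Finset.sum_congr rfl fun i _ => ?_
  rw [integral_finsetSum _ fun j _ => i1 i j, integral_finsetSum _ fun j _ => i2 i j]
  refine Finset.sum_congr rfl fun j _ => ?_
  rw [integral_sphere_mul_rot i j hf (contDiff_rot i j hg),
    integral_sphere_mul_rot i j (contDiff_rot i j hf) hg, neg_neg]

/-! ### Harmonic polynomials -/

/-- The Laplacian on polynomials. -/
noncomputable def polyLap : MvPolynomial (Fin 4) ℝ →ₗ[ℝ] MvPolynomial (Fin 4) ℝ :=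
  ∑ i, (MvPolynomial.pderiv i).toLinearMap ∘ₗ (MvPolynomial.pderiv i).toLinearMap

lemma polyLap_apply (p : MvPolynomial (Fin 4) ℝ) :
    polyLap p = ∑ i, MvPolynomial.pderiv i (MvPolynomial.pderiv i p) := by
  simp [polyLap]

/-- The polynomial `|x|²`. -/
noncomputable def rsq : MvPolynomial (Fin 4) ℝ := ∑ i, MvPolynomial.X i ^ 2

lemma isHomogeneous_rsq : rsq.IsHomogeneous 2 :=
  MvPolynomial.IsHomogeneous.sum _ _ _ fun i _ => MvPolynomial.isHomogeneous_X_pow i 2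

lemma pderiv_rsq (i : Fin 4) : MvPolynomial.pderiv i rsq = 2 * MvPolynomial.X i := by
  fin_cases i <;> simp [rsq, Fin.sum_univ_four, Derivation.leibniz_pow, MvPolynomial.pderiv_X,
    nsmul_eq_mul]

/-- The summand 8 is `Δ|x|²`, and the cross term `4 ∑ x_i ∂_i p` is `4 d p` by Euler's identity. -/
lemma polyLap_rsq_mul {p : MvPolynomial (Fin 4) ℝ} {d : ℕ} (hp : p.IsHomogeneous d) :
    polyLap (rsq * p) = (8 + 4 * d : ℕ) • p + rsq * polyLap p := by
  have h := hp.sum_X_mul_pderiv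
  have h1 : ∀ i, MvPolynomial.pderiv i (MvPolynomial.pderiv i (rsq * p)) =
      2 * p + 4 * (MvPolynomial.X i * MvPolynomial.pderiv i p)
        + rsq * MvPolynomial.pderiv i (MvPolynomial.pderiv i p) := fun i => by
    have h2 : MvPolynomial.pderiv i (2 : MvPolynomial (Fin 4) ℝ) = 0 :=
      MvPolynomial.pderiv_C (a := (2 : ℝ))
    simp only [MvPolynomial.pderiv_mul, pderiv_rsq, map_add, MvPolynomial.pderiv_X_self, h2]
    ring
  simp only [polyLap_apply, h1, Finset.sum_add_distrib, ← Finset.mul_sum, h]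
  simp [nsmul_eq_mul]
  ring

/-- The constant is never zero. This makes `Δ` invertible from the multiples of `|x|^{2(m+1)} q` to
those of `|x|^{2m} q`, and it drives both the Fischer decomposition and the moment recurrence for
weakly harmonic functions. -/
lemma polyLap_rsq_pow_mul {q : MvPolynomial (Fin 4) ℝ} {j : ℕ} (hq : q ∈ harmonicPolynomials j)
    (m : ℕ) : polyLap (rsq ^ (m + 1) * q) = (4 * (m + 1) * (m + 2 + j)) • (rsq ^ m * q) := by
  induction m with
  | zero =>
    have h := polyLap_rsq_mul hq.1
    rw [polyLap_apply q, hq.2] at h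
    simp only [zero_add, pow_one, pow_zero, one_mul, h, mul_zero, add_zero]
    congr 1
    ring
  | succ m ih =>
    have hh : (rsq ^ (m + 1) * q).IsHomogeneous (2 * (m + 1) + j) :=
      (isHomogeneous_rsq.pow _).mul hq.1
    rw [pow_succ' rsq (m + 1), mul_assoc, polyLap_rsq_mul hh, ih, mul_smul_comm, ← mul_assoc,
      ← pow_succ', ← add_smul]
    congr 1
    ring

lemma isHomogeneous_polyLap {p : MvPolynomial (Fin 4) ℝ} {d : ℕ} (hp : p.IsHomogeneous (d + 2)) :
    (polyLap p).IsHomogeneous d := by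
  rw [polyLap_apply]
  refine MvPolynomial.IsHomogeneous.sum _ _ _ fun i _ => ?_
  exact (hp.pderiv (i := i)).pderiv (i := i)

lemma polyLap_eq_zero_of_le_one {p : MvPolynomial (Fin 4) ℝ} {d : ℕ} (hd : d ≤ 1)
    (hp : p.IsHomogeneous d) : polyLap p = 0 := by
  rw [polyLap_apply]
  refine Finset.sum_eq_zero fun i _ => ?_
  have h := hp.pderiv (i := i)
  -- With truncated subtraction `d - 1 = 0` for both `d = 0` and `d = 1`, so the first partial
  -- derivatives are constants.
  rw [Nat.sub_eq_zero_of_le hd, ← MvPolynomial.totalDegree_zero_iff_isHomogeneous,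
    MvPolynomial.totalDegree_eq_zero_iff_eq_C] at h
  rw [h, MvPolynomial.pderiv_C]

/-- The span of the products `|x|^{2m} q` of degree `k` with `q` harmonic and homogeneous. -/
noncomputable def fischerSpan (k : ℕ) : Submodule ℝ (MvPolynomial (Fin 4) ℝ) :=
  Submodule.span ℝ {p | ∃ m j, 2 * m + j = k ∧ ∃ q ∈ harmonicPolynomials j, p = rsq ^ m * q}

/-- On each generator, divide by the nonzero constant of `polyLap_rsq_pow_mul`; the rest is
linearity. -/
lemma exists_polyLap_rsq_mul {k : ℕ} {r : MvPolynomial (Fin 4) ℝ} (hr : r ∈ fischerSpan k) :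
    ∃ s ∈ fischerSpan k, polyLap (rsq * s) = r := by
  induction hr using Submodule.span_induction with
  | mem x hx =>
    obtain ⟨m, j, hk, q, hq, rfl⟩ := hx
    have hc : ((4 * (m + 1) * (m + 2 + j) : ℕ) : ℝ) ≠ 0 := by positivity
    refine ⟨((4 * (m + 1) * (m + 2 + j) : ℕ) : ℝ)⁻¹ • (rsq ^ m * q),
      Submodule.smul_mem _ _ (Submodule.subset_span ⟨m, j, hk, q, hq, rfl⟩), ?_⟩
    rw [mul_smul_comm, map_smul, ← mul_assoc, ← pow_succ', polyLap_rsq_pow_mul hq,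
      ← Nat.cast_smul_eq_nsmul ℝ, smul_smul, inv_mul_cancel₀ hc, one_smul]
  | zero => exact ⟨0, Submodule.zero_mem _, by simp⟩
  | add x y _ _ hx hy =>
    obtain ⟨s, hs, hs'⟩ := hx
    obtain ⟨t, ht, ht'⟩ := hy
    exact ⟨s + t, Submodule.add_mem _ hs ht, by rw [mul_add, map_add, hs', ht']⟩
  | smul a x _ hx =>
    obtain ⟨s, hs, hs'⟩ := hx
    exact ⟨a • s, Submodule.smul_mem _ _ hs, by rw [mul_smul_comm, map_smul, hs']⟩

lemma fischerSpan_le (k : ℕ) : fischerSpan k ≤ MvPolynomial.homogeneousSubmodule (Fin 4) ℝ k := by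
  refine Submodule.span_le.2 ?_
  rintro _ ⟨m, j, rfl, q, hq, rfl⟩
  exact (isHomogeneous_rsq.pow _).mul hq.1

lemma rsq_mul_mem_fischerSpan {k : ℕ} {s : MvPolynomial (Fin 4) ℝ} (hs : s ∈ fischerSpan k) :
    rsq * s ∈ fischerSpan (k + 2) := by
  induction hs using Submodule.span_induction with
  | mem x hx =>
    obtain ⟨m, j, hk, q, hq, rfl⟩ := hx
    exact Submodule.subset_span ⟨m + 1, j, by omega, q, hq, by ring⟩
  | zero => simp
  | add x y _ _ hx hy => rw [mul_add]; exact Submodule.add_mem _ hx hy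
  | smul a x _ hx => rw [mul_smul_comm]; exact Submodule.smul_mem _ _ hx

/-- Fischer decomposition, by induction in steps of two. The induction hypothesis puts `Δ p` in the
span, so some `s` in the span satisfies `Δ(|x|² s) = Δ p`, and `p - |x|² s` is harmonic. -/
lemma mem_fischerSpan {k : ℕ} {p : MvPolynomial (Fin 4) ℝ} (hp : p.IsHomogeneous k) :
    p ∈ fischerSpan k := by
  induction k using Nat.strong_induction_on generalizing p with
  | _ k ih =>
    rcases le_or_gt k 1 with hk | hk
    · exact Submodule.subset_span ⟨0, k, by omega, p,
        ⟨hp, by rw [← polyLap_apply]; exact polyLap_eq_zero_of_le_one hk hp⟩, by simp⟩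
    · obtain ⟨d, rfl⟩ : ∃ d, k = d + 2 := ⟨k - 2, by omega⟩
      obtain ⟨s, hs, hs'⟩ := exists_polyLap_rsq_mul (ih d (by omega) (isHomogeneous_polyLap hp))
      have h1 := rsq_mul_mem_fischerSpan hs
      have h2 : p - rsq * s ∈ fischerSpan (d + 2) := by
        refine Submodule.subset_span ⟨0, d + 2, by omega, p - rsq * s, ⟨?_, ?_⟩, by simp⟩
        · exact hp.sub (fischerSpan_le _ h1)
        · rw [← polyLap_apply, map_sub, hs', sub_self]
      simpa using Submodule.add_mem _ h2 h1

lemma exists_polyLap_eq {k : ℕ} {r : MvPolynomial (Fin 4) ℝ} (hr : r.IsHomogeneous k) :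
    ∃ p, p.IsHomogeneous (k + 2) ∧ polyLap p = r := by
  obtain ⟨s, hs, hs'⟩ := exists_polyLap_rsq_mul (mem_fischerSpan hr)
  exact ⟨rsq * s, fischerSpan_le _ (rsq_mul_mem_fischerSpan hs), hs'⟩

/-- Every polynomial is a linear combination of products `|x|^{2m} q`. -/
lemma polynomial_induction {P : MvPolynomial (Fin 4) ℝ → Prop}
    (h : ∀ m j, ∀ q ∈ harmonicPolynomials j, P (rsq ^ m * q)) (h0 : P 0)
    (hadd : ∀ p q, P p → P q → P (p + q)) (hsmul : ∀ (c : ℝ) p, P p → P (c • p))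
    (p : MvPolynomial (Fin 4) ℝ) : P p := by
  have h1 : ∀ k, ∀ r ∈ fischerSpan k, P r := fun k r hr => by
    induction hr using Submodule.span_induction with
    | mem x hx => obtain ⟨m, j, -, q, hq, rfl⟩ := hx; exact h m j q hq
    | zero => exact h0
    | add x y _ _ hx hy => exact hadd _ _ hx hy
    | smul a x _ hx => exact hsmul _ _ hx
  rw [← MvPolynomial.sum_homogeneousComponent p]
  refine Finset.sum_induction _ P hadd h0 fun k _ => h1 k _ (mem_fischerSpan ?_)
  exact MvPolynomial.homogeneousComponent_isHomogeneous k p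

lemma polyLap_surjective : Function.Surjective polyLap := by
  intro p
  rw [← MvPolynomial.sum_homogeneousComponent p]
  refine Finset.sum_induction _ (fun p => ∃ q, polyLap q = p) ?_ ⟨0, by simp⟩ fun k _ => ?_
  · rintro _ _ ⟨p, rfl⟩ ⟨q, rfl⟩
    exact ⟨p + q, map_add _ _ _⟩
  · obtain ⟨q, -, hq⟩ := exists_polyLap_eq (MvPolynomial.homogeneousComponent_isHomogeneous k p)
    exact ⟨q, hq⟩

/-- Homogeneous harmonic polynomials as a subspace. -/
noncomputable def harmonicSubmodule (k : ℕ) : Submodule ℝ (MvPolynomial (Fin 4) ℝ) :=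
  MvPolynomial.homogeneousSubmodule (Fin 4) ℝ k ⊓ LinearMap.ker polyLap

lemma mem_harmonicSubmodule {k : ℕ} {p : MvPolynomial (Fin 4) ℝ} :
    p ∈ harmonicSubmodule k ↔ p ∈ harmonicPolynomials k := by
  rw [harmonicSubmodule, Submodule.mem_inf, LinearMap.mem_ker, polyLap_apply]
  rfl

/-! ### Dimensions of the spaces of homogeneous and harmonic polynomials -/

instance (k : ℕ) : FiniteDimensional ℝ (MvPolynomial.homogeneousSubmodule (Fin 4) ℝ k) :=
  Module.Finite.of_fg (MvPolynomial.homogeneousSubmodule_fg (Fin 4) ℝ k)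

instance (k : ℕ) : FiniteDimensional ℝ (harmonicSubmodule k) :=
  Submodule.finiteDimensional_of_le inf_le_left

lemma finrank_homogeneousSubmodule (k : ℕ) :
    Module.finrank ℝ (MvPolynomial.homogeneousSubmodule (Fin 4) ℝ k) = (k + 3).choose 3 := by
  set s := (Finset.univ : Finset (Fin 4)).finsuppAntidiag k
  have hs : ∀ d : Fin 4 →₀ ℕ, d ∈ s ↔ d.degree = k := fun d => by
    simp [s, Finset.mem_finsuppAntidiag, Finsupp.degree_eq_sum]
  have hli : LinearIndependent ℝ fun d : s => (MvPolynomial.monomial d.1 (1 : ℝ)) := by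
    have := (MvPolynomial.basisMonomials (Fin 4) ℝ).linearIndependent
    rw [MvPolynomial.coe_basisMonomials] at this
    exact this.comp _ Subtype.val_injective
  have hspan : Submodule.span ℝ (range fun d : s => (MvPolynomial.monomial d.1 (1 : ℝ))) =
      MvPolynomial.homogeneousSubmodule (Fin 4) ℝ k := by
    refine le_antisymm (Submodule.span_le.2 ?_) fun p hp => ?_
    · rintro _ ⟨d, rfl⟩
      exact MvPolynomial.isHomogeneous_monomial 1 ((hs _).1 d.2)
    · rw [p.as_sum]
      refine Submodule.sum_mem _ fun d hd => ?_
      have hdk : d ∈ s := by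
        rw [hs]
        by_contra hne
        exact (MvPolynomial.mem_support_iff.1 hd)
          (MvPolynomial.IsHomogeneous.coeff_eq_zero hp hne)
      have : MvPolynomial.monomial d (MvPolynomial.coeff d p) =
          MvPolynomial.coeff d p • MvPolynomial.monomial d (1 : ℝ) := by
        rw [MvPolynomial.smul_monomial, smul_eq_mul, mul_one]
      rw [this]
      exact Submodule.smul_mem _ _ (Submodule.subset_span ⟨⟨d, hdk⟩, rfl⟩)
  rw [← hspan, finrank_span_eq_card hli, Fintype.card_coe,
    Finset.card_finsuppAntidiag_nat_eq_choose, Finset.card_univ, Fintype.card_fin,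
    show 4 + k - 1 = k + 3 by omega, Nat.choose_symm_add]

lemma choose_three_step (k : ℕ) : (k + 5).choose 3 = (k + 3) ^ 2 + (k + 3).choose 3 := by
  have h1 : (k + 5).choose 3 = (k + 4).choose 2 + (k + 4).choose 3 := Nat.choose_succ_succ _ _
  have h2 : (k + 4).choose 3 = (k + 3).choose 2 + (k + 3).choose 3 := Nat.choose_succ_succ _ _
  have h3 : (k + 4).choose 2 = (k + 3).choose 1 + (k + 3).choose 2 := Nat.choose_succ_succ _ _
  have h4 : (k + 3).choose 2 * 2 = (k + 3) * (k + 2) := by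
    rw [Nat.choose_two_right]
    exact Nat.div_mul_cancel (Nat.even_mul_pred_self (k + 3)).two_dvd
  rw [Nat.choose_one_right] at h3
  nlinarith

/-- Rank–nullity for `Δ`, which maps the homogeneous polynomials of degree `d + 2` onto those of
degree `d`; the difference of the two binomial coefficients is `(d + 3)²`. -/
lemma finrank_harmonicSubmodule (k : ℕ) :
    Module.finrank ℝ (harmonicSubmodule k) = (k + 1) ^ 2 := by
  rcases le_or_gt k 1 with hk | hk
  · have : harmonicSubmodule k = MvPolynomial.homogeneousSubmodule (Fin 4) ℝ k :=
      inf_eq_left.2 fun p hp => polyLap_eq_zero_of_le_one hk hp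
    rw [this, finrank_homogeneousSubmodule]
    interval_cases k <;> rfl
  · obtain ⟨d, rfl⟩ : ∃ d, k = d + 2 := ⟨k - 2, by omega⟩
    set V := MvPolynomial.homogeneousSubmodule (Fin 4) ℝ (d + 2)
    have h := LinearMap.finrank_range_add_finrank_ker (polyLap.domRestrict V)
    have hr : LinearMap.range (polyLap.domRestrict V) =
        MvPolynomial.homogeneousSubmodule (Fin 4) ℝ d := by
      refine le_antisymm ?_ fun r hr => ?_
      · rintro _ ⟨p, rfl⟩
        exact isHomogeneous_polyLap p.2
      · obtain ⟨p, hp, rfl⟩ := exists_polyLap_eq hr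
        exact ⟨⟨p, hp⟩, rfl⟩
    have hkr : (LinearMap.ker (polyLap.domRestrict V)).map V.subtype = harmonicSubmodule (d + 2) := by
      ext p
      simp [harmonicSubmodule, V, and_comm]
    rw [hr, ← Submodule.finrank_map_subtype_eq, hkr, finrank_homogeneousSubmodule,
      finrank_homogeneousSubmodule, choose_three_step] at h
    linarith

/-! ### Polynomial functions -/

/-- The function on `ℝ⁴` defined by a polynomial. -/
noncomputable def polyFun (p : MvPolynomial (Fin 4) ℝ) (x : E4) : ℝ :=
  MvPolynomial.eval (fun i => x i) p

lemma polyFun_X (i : Fin 4) : polyFun (MvPolynomial.X i) = fun x => x i := by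
  funext x; simp [polyFun]

lemma polyFun_add (p q : MvPolynomial (Fin 4) ℝ) :
    polyFun (p + q) = fun x => polyFun p x + polyFun q x := by
  funext x; simp [polyFun]

lemma polyFun_mul (p q : MvPolynomial (Fin 4) ℝ) :
    polyFun (p * q) = fun x => polyFun p x * polyFun q x := by
  funext x; simp [polyFun]

lemma polyFun_smul (c : ℝ) (p : MvPolynomial (Fin 4) ℝ) :
    polyFun (c • p) = fun x => c * polyFun p x := by
  funext x; simp [polyFun, MvPolynomial.smul_eval]

lemma polyFun_rsq : polyFun rsq = fun x => ‖x‖ ^ 2 := by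
  funext x; simp [polyFun, rsq, norm_sq_eq_sum]

lemma contDiff_polyFun (p : MvPolynomial (Fin 4) ℝ) : ContDiff ℝ ∞ (polyFun p) := by
  induction p using MvPolynomial.induction_on with
  | C a =>
    have : polyFun (MvPolynomial.C a) = fun _ => a := by funext x; simp [polyFun]
    rw [this]; exact contDiff_const
  | add p q hp hq => rw [polyFun_add]; exact hp.add hq
  | mul_X p i hp => rw [polyFun_mul, polyFun_X]; exact hp.mul (contDiff_coord i)

lemma partialD_polyFun (i : Fin 4) (p : MvPolynomial (Fin 4) ℝ) :
    partialD i (polyFun p) = polyFun (MvPolynomial.pderiv i p) := by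
  induction p using MvPolynomial.induction_on with
  | C a =>
    have : polyFun (MvPolynomial.C a) = fun _ => a := by funext x; simp [polyFun]
    funext x
    rw [this, partialD_const]; simp [polyFun]
  | add p q hp hq =>
    funext x
    rw [polyFun_add, map_add, polyFun_add, ← hp, ← hq,
      partialD_add (smooth_diff (contDiff_polyFun p) x) (smooth_diff (contDiff_polyFun q) x)]
  | mul_X p j hp =>
    funext x
    have h := partialD_mul (i := i) (smooth_diff (contDiff_polyFun p) x)
      (smooth_diff (contDiff_coord j) x)
    rw [polyFun_mul, polyFun_X, h, MvPolynomial.pderiv_mul, polyFun_add, polyFun_mul, polyFun_mul,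
      ← hp, partialD_coord, polyFun_X, MvPolynomial.pderiv_X]
    by_cases hij : i = j
    · subst hij; simp [polyFun, add_comm]
    · simp [polyFun, hij, Ne.symm hij]

lemma lap_polyFun (p : MvPolynomial (Fin 4) ℝ) : lap (polyFun p) = polyFun (polyLap p) := by
  rw [lap_eq (contDiff_polyFun p), polyLap_apply]
  funext x
  simp only [partialD_polyFun]
  simp [polyFun]

lemma normalD_polyFun {p : MvPolynomial (Fin 4) ℝ} {k : ℕ} (hp : p.IsHomogeneous k) :
    normalD (polyFun p) = fun x => k * polyFun p x := by
  funext x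
  have h := congrArg (MvPolynomial.eval fun i => x i) hp.sum_X_mul_pderiv
  rw [normalD_eq]
  simp only [partialD_polyFun]
  simpa [polyFun, nsmul_eq_mul] using h

lemma lap_harmonic {p : MvPolynomial (Fin 4) ℝ} {k : ℕ} (hp : p ∈ harmonicPolynomials k) :
    lap (polyFun p) = fun _ => 0 := by
  rw [lap_polyFun, polyLap_apply, hp.2]; funext x; simp [polyFun]

lemma polyFun_smul_point {p : MvPolynomial (Fin 4) ℝ} {k : ℕ} (hp : p.IsHomogeneous k) (c : ℝ)
    (x : E4) : polyFun p (c • x) = c ^ k * polyFun p x := by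
  unfold polyFun
  rw [MvPolynomial.eval_eq, MvPolynomial.eval_eq, Finset.mul_sum]
  refine Finset.sum_congr rfl fun d hd => ?_
  have hdk := hp.degree_eq_sum_deg_support hd
  simp only [PiLp.smul_apply, smul_eq_mul, mul_pow]
  rw [Finset.prod_mul_distrib, Finset.prod_pow_eq_pow_sum, ← hdk]
  ring

lemma eq_zero_of_polyFun_eq_zero_on_ball {p : MvPolynomial (Fin 4) ℝ} {k : ℕ}
    (hp : p.IsHomogeneous k) (h : ∀ x ∈ ball (0 : E4) 1, polyFun p x = 0) : p = 0 := by
  refine MvPolynomial.funext fun v => ?_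
  set x : E4 := WithLp.toLp 2 v with hx
  have hpos : 0 < ‖x‖ + 1 := by positivity
  -- Every point scales into the ball, and homogeneity carries the vanishing back.
  have h1 := h ((‖x‖ + 1)⁻¹ • x) (by
    rw [mem_ball_zero_iff, norm_smul, norm_inv, Real.norm_of_nonneg hpos.le, inv_mul_lt_iff₀ hpos]
    linarith)
  rw [polyFun_smul_point hp] at h1
  have h2 : polyFun p x = 0 := by
    rcases mul_eq_zero.1 h1 with h3 | h3
    · exact absurd h3 (by positivity)
    · exact h3
  simpa [polyFun, hx] using h2

/-! ### Density of polynomials -/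

/-- Stone–Weierstrass: the coordinates already separate points. -/
lemma exists_polyFun_near {f : E4 → ℝ} (hf : Continuous f) {K : Set E4} (hK : IsCompact K)
    {ε : ℝ} (hε : 0 < ε) : ∃ p, ∀ x ∈ K, |polyFun p x - f x| < ε := by
  let A : MvPolynomial (Fin 4) ℝ →ₐ[ℝ] C(E4, ℝ) := MvPolynomial.aeval fun i =>
    (⟨fun x => x i, (contDiff_coord i (n := 0)).continuous⟩ : C(E4, ℝ))
  have hA : ∀ p x, A p x = polyFun p x := fun p x => by
    induction p using MvPolynomial.induction_on with
    | C a => simp [A, polyFun]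
    | add p q hp hq => rw [map_add, polyFun_add, ContinuousMap.add_apply, hp, hq]
    | mul_X p i hp =>
      rw [map_mul, polyFun_mul, ContinuousMap.mul_apply, hp, polyFun_X]
      simp [A]
  have hsep : A.range.SeparatesPoints := by
    intro x y hxy
    obtain ⟨i, hi⟩ : ∃ i, x i ≠ y i := by
      by_contra! h
      exact hxy (PiLp.ext h)
    refine ⟨A (MvPolynomial.X i), ⟨_, ⟨MvPolynomial.X i, rfl⟩, rfl⟩, ?_⟩
    simpa only [hA, polyFun_X] using hi
  obtain ⟨g, ⟨p, rfl⟩, hg⟩ :=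
    ContinuousMap.exists_mem_subalgebra_near_continuous_of_isCompact_of_separatesPoints hsep
      ⟨f, hf⟩ hK hε
  refine ⟨p, fun x hx => ?_⟩
  rw [← hA]
  exact hg x hx

/-- The map `ι` lets the ball (identity) and the sphere (inclusion) share one approximation
argument. -/
lemma integral_eq_zero_of_polyFun {α : Type*} [MeasurableSpace α] {μ : Measure α} {u : α → ℝ}
    {ι : α → E4} {K : Set E4} (hK : IsCompact K) (hι : ∀ᵐ x ∂μ, ι x ∈ K)
    (hu : Integrable u μ)
    (hint : ∀ f : E4 → ℝ, Continuous f → Integrable (fun x => u x * f (ι x)) μ)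
    (h : ∀ p, ∫ x, u x * polyFun p (ι x) ∂μ = 0) {f : E4 → ℝ} (hf : Continuous f) :
    ∫ x, u x * f (ι x) ∂μ = 0 := by
  set I := ∫ x, |u x| ∂μ with hI
  have hI0 : 0 ≤ I := integral_nonneg fun x => abs_nonneg _
  refine abs_eq_zero.1 (le_antisymm (le_of_forall_pos_le_add fun ε hε => ?_) (abs_nonneg _))
  -- Dividing by `I + 1` instead of `I` covers the case where `u` has zero `L¹` norm.
  obtain ⟨p, hp⟩ := exists_polyFun_near hf hK (ε := ε / (I + 1)) (by positivity)
  have h1 := hint f hf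
  have h2 := hint _ (contDiff_polyFun p).continuous
  have h3 : ∫ x, u x * f (ι x) ∂μ = ∫ x, (u x * f (ι x) - u x * polyFun p (ι x)) ∂μ := by
    rw [integral_sub h1 h2, h p, sub_zero]
  have h4 : ∫ x, |u x| * (ε / (I + 1)) ∂μ = I * (ε / (I + 1)) := integral_mul_const _ _
  rw [zero_add, h3]
  refine (abs_integral_le_integral_abs).trans ((integral_mono_ae (h1.sub h2).abs
    (hu.abs.mul_const (ε / (I + 1))) ?_).trans ?_)
  · filter_upwards [hι] with x hx
    simp only [Pi.sub_apply]
    rw [← mul_sub, abs_mul, abs_sub_comm]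
    exact mul_le_mul_of_nonneg_left (hp _ hx).le (abs_nonneg _)
  · rw [h4, mul_div_assoc', div_le_iff₀ (by positivity)]
    nlinarith

/-! ### Elements of `L²` determined by their integrals against test functions and polynomials -/

lemma integrable_L2Ball (u : L2Ball) : Integrable (fun x => u x) ballMeasure :=
  (Lp.memLp u).integrable (by norm_num)

lemma eq_zero_of_ballInt_test {u : L2Ball} (h : ∀ η, IsTest η → ballInt u η = 0) : u = 0 := by
  have hu := integrable_L2Ball u
  have h1 : ∀ᵐ x ∂(volume : Measure E4), x ∈ ball (0 : E4) 1 → u x = 0 := by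
    refine isOpen_ball.ae_eq_zero_of_integral_contDiff_smul_eq_zero
      (IntegrableOn.locallyIntegrableOn hu) fun g hg hc hs => ?_
    rw [← h g ⟨hg, hc, hs⟩, ballInt]
    rw [← setIntegral_eq_integral_of_forall_compl_eq_zero (s := ball (0 : E4) 1) (fun x hx => by
      rw [image_eq_zero_of_notMem_tsupport fun h => hx (hs h), zero_smul])]
    simp only [smul_eq_mul, mul_comm]
  refine (Lp.eq_zero_iff_ae_eq_zero).2 ?_
  rw [Filter.EventuallyEq, ae_restrict_iff' measurableSet_ball]
  exact h1

lemma eq_zero_of_ballInt_polyFun {u : L2Ball} (h : ∀ p, ballInt u (polyFun p) = 0) : u = 0 := by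
  refine eq_zero_of_ballInt_test fun η hη => ?_
  refine integral_eq_zero_of_polyFun (ι := id) (isCompact_closedBall (0 : E4) 1) ?_
    (integrable_L2Ball u) (fun f hf => ball_integrable u hf) h hη.1.continuous
  filter_upwards [ae_restrict_mem measurableSet_ball] with x hx using ball_subset_closedBall hx

lemma eq_zero_of_sphereInt_polyFun {t : L2Sphere} (h : ∀ p, sphereInt t (polyFun p) = 0) :
    t = 0 := by
  refine (ContinuousMap.toLp_denseRange ℝ sphereMeasure ℝ (p := 2) (by norm_num)).eq_zero_of_inner_left
    ℝ fun f => ?_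
  obtain ⟨g, hg⟩ := ContinuousMap.exists_restrict_eq (isClosed_sphere (x := (0 : E4)) (ε := 1)) f
  have hgf : ∀ x : S3, g x = f x := fun x => DFunLike.congr_fun hg x
  have h0 := integral_eq_zero_of_polyFun (μ := sphereMeasure) (u := fun x => t x)
    (ι := fun x : S3 => (x : E4)) (isCompact_sphere (0 : E4) 1)
    (Filter.Eventually.of_forall fun x => x.2) ((Lp.memLp t).integrable (by norm_num))
    (fun f hf => sphere_integrable t hf.continuousOn) h g.continuous
  rw [L2.inner_def, ← h0]
  refine integral_congr_ae ?_
  filter_upwards [ContinuousMap.coeFn_toLp (p := 2) (𝕜 := ℝ) sphereMeasure f] with x hx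
  rw [hx, hgf]
  simp [mul_comm]

/-! ### Linearity in the test function, and uniqueness of weak objects -/

lemma ballInt_sub (u v : L2Ball) {f : E4 → ℝ} (hf : Continuous f) :
    ballInt (u - v) f = ballInt u f - ballInt v f := by
  have h := ballInt_add (u - v) v hf
  rw [sub_add_cancel] at h
  linarith

lemma sphereInt_sub (s t : L2Sphere) {f : E4 → ℝ} (hf : ContinuousOn f (sphere (0 : E4) 1)) :
    sphereInt (s - t) f = sphereInt s f - sphereInt t f := by
  have h := sphereInt_add (s - t) t hf
  rw [sub_add_cancel] at h
  linarith

lemma ballInt_fun_add (u : L2Ball) {f g : E4 → ℝ} (hf : Continuous f) (hg : Continuous g) :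
    ballInt u (fun x => f x + g x) = ballInt u f + ballInt u g := by
  unfold ballInt
  rw [← integral_add (ball_integrable u hf) (ball_integrable u hg)]
  simp only [mul_add]

lemma ballInt_fun_smul (u : L2Ball) (c : ℝ) (f : E4 → ℝ) :
    ballInt u (fun x => c * f x) = c * ballInt u f := by
  unfold ballInt
  rw [← integral_const_mul]
  simp only [mul_left_comm]

lemma ballInt_fun_sum {ι : Type*} (s : Finset ι) (u : L2Ball) {f : ι → E4 → ℝ}
    (hf : ∀ i, Continuous (f i)) :
    ballInt u (fun x => ∑ i ∈ s, f i x) = ∑ i ∈ s, ballInt u (f i) := by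
  unfold ballInt
  rw [← integral_finsetSum _ fun i _ => ball_integrable u (hf i)]
  simp only [Finset.mul_sum]

lemma sphereInt_fun_sum {ι : Type*} (s : Finset ι) (t : L2Sphere) {f : ι → E4 → ℝ}
    (hf : ∀ i, Continuous (f i)) :
    sphereInt t (fun x => ∑ i ∈ s, f i x) = ∑ i ∈ s, sphereInt t (f i) := by
  unfold sphereInt
  rw [← integral_finsetSum _ fun i _ => sphere_integrable t (hf i).continuousOn]
  simp only [Finset.mul_sum]

lemma sphereInt_fun_add (t : L2Sphere) {f g : E4 → ℝ} (hf : Continuous f) (hg : Continuous g) :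
    sphereInt t (fun x => f x + g x) = sphereInt t f + sphereInt t g := by
  unfold sphereInt
  rw [← integral_add (sphere_integrable t hf.continuousOn) (sphere_integrable t hg.continuousOn)]
  simp only [mul_add]

lemma sphereInt_fun_smul (t : L2Sphere) (c : ℝ) (f : E4 → ℝ) :
    sphereInt t (fun x => c * f x) = c * sphereInt t f := by
  unfold sphereInt
  rw [← integral_const_mul]
  simp only [mul_left_comm]

lemma sphereInt_congr (t : L2Sphere) {f g : E4 → ℝ} (h : ∀ x ∈ sphere (0 : E4) 1, f x = g x) :
    sphereInt t f = sphereInt t g := by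
  unfold sphereInt
  refine integral_congr_ae (Filter.Eventually.of_forall fun x => ?_)
  simp only [h x x.2]

/-- Integration of polynomials against an element of `L²(B⁴)`. -/
noncomputable def ballFunctional (u : L2Ball) : MvPolynomial (Fin 4) ℝ →ₗ[ℝ] ℝ where
  toFun p := ballInt u (polyFun p)
  map_add' p q := by
    rw [polyFun_add, ballInt_fun_add u (contDiff_polyFun p).continuous
      (contDiff_polyFun q).continuous]
  map_smul' c p := by rw [polyFun_smul, ballInt_fun_smul]; rfl

/-- Integration of polynomials against an element of `L²(S³)`. -/
noncomputable def sphereFunctional (t : L2Sphere) : MvPolynomial (Fin 4) ℝ →ₗ[ℝ] ℝ where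
  toFun p := sphereInt t (polyFun p)
  map_add' p q := by
    rw [polyFun_add, sphereInt_fun_add t (contDiff_polyFun p).continuous
      (contDiff_polyFun q).continuous]
  map_smul' c p := by rw [polyFun_smul, sphereInt_fun_smul]; rfl

/-- On the sphere `|x|^{2m} q = q`, so by the Fischer decomposition the harmonic polynomials have
the same restrictions as all polynomials, which are dense. -/
lemma eq_zero_of_sphereInt_harmonic {t : L2Sphere}
    (h : ∀ j, ∀ q ∈ harmonicPolynomials j, sphereInt t (polyFun q) = 0) : t = 0 := by
  refine eq_zero_of_sphereInt_polyFun fun p => ?_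
  change sphereFunctional t p = 0
  induction p using polynomial_induction with
  | h m j q hq =>
    refine Eq.trans (sphereInt_congr t fun x hx => ?_) (h j q hq)
    have hx1 : polyFun rsq x = 1 := by
      rw [polyFun_rsq]; simp only [mem_sphere_zero_iff_norm.1 hx, one_pow]
    simp only [polyFun, map_mul, map_pow] at hx1 ⊢
    rw [hx1, one_pow, one_mul]
  | h0 => exact map_zero _
  | hadd p q hp hq => rw [map_add, hp, hq, add_zero]
  | hsmul c p hp => rw [map_smul, hp, smul_zero]

lemma HasWeakPartial.unique {i : Fin 4} {u v v' : L2Ball} (h : HasWeakPartial i u v)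
    (h' : HasWeakPartial i u v') : v = v' := by
  refine sub_eq_zero.1 (eq_zero_of_ballInt_test fun η hη => ?_)
  have h1 := h η hη
  have h2 := h' η hη
  rw [ballInt_sub _ _ hη.1.continuous]
  linarith

lemma HasWeakGrad.unique {u : L2Ball} {g g' : Fin 4 → L2Ball} (h : HasWeakGrad u g)
    (h' : HasWeakGrad u g') : g = g' := funext fun i => (h i).unique (h' i)

lemma HasWeakLap.unique {u w w' : L2Ball} (h : HasWeakLap u w) (h' : HasWeakLap u w') :
    w = w' := by
  refine sub_eq_zero.1 (eq_zero_of_ballInt_test fun η hη => ?_)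
  rw [ballInt_sub _ _ hη.1.continuous, ← h η hη, ← h' η hη, sub_self]

/-- The trace is seen only through the products `t ν_i`. Testing the `i`-th identity with `p x_i`
and summing recovers `∫ t p`, because `∑ x_i² = 1` on the sphere. -/
lemma HasTrace.unique {u : L2Ball} {t t' : L2Sphere} (h : HasTrace u t) (h' : HasTrace u t') :
    t = t' := by
  obtain ⟨g, hg, k⟩ := h
  obtain ⟨g', hg', k'⟩ := h'
  obtain rfl := hg.unique hg'
  refine sub_eq_zero.1 (eq_zero_of_sphereInt_polyFun fun p => ?_)
  have hp := contDiff_polyFun p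
  have h1 : ∀ i, sphereInt (t - t') (fun x => (polyFun p x * x i) * x i) = 0 := fun i => by
    have hs := hp.mul (contDiff_coord i)
    rw [sphereInt_sub _ _ (hs.mul (contDiff_coord i)).continuous.continuousOn, ← k i _ hs,
      ← k' i _ hs, sub_self]
  have h2 : sphereInt (t - t') (fun x => ∑ i, (polyFun p x * x i) * x i) = 0 := by
    rw [sphereInt_fun_sum Finset.univ _ fun i =>
      ((hp.mul (contDiff_coord i)).mul (contDiff_coord i)).continuous]
    simp [h1]
  rw [← h2]
  refine sphereInt_congr _ fun x hx => ?_
  have h3 : ∑ i, x i ^ 2 = 1 := by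
    rw [← norm_sq_eq_sum, mem_sphere_zero_iff_norm.1 hx, one_pow]
  simp only [mul_assoc, ← Finset.mul_sum, ← sq, h3, mul_one]

lemma HasNormalDeriv.unique {u : L2Ball} {n n' : L2Sphere} (h : HasNormalDeriv u n)
    (h' : HasNormalDeriv u n') : n = n' := by
  obtain ⟨g, w, hg, hw, k⟩ := h
  obtain ⟨g', w', hg', hw', k'⟩ := h'
  obtain rfl := hg.unique hg'
  obtain rfl := hw.unique hw'
  refine sub_eq_zero.1 (eq_zero_of_sphereInt_polyFun fun p => ?_)
  have hp := contDiff_polyFun p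
  rw [sphereInt_sub _ _ hp.continuous.continuousOn, ← k _ hp, ← k' _ hp, sub_self]

/-- Green's second identity for functions with weak Laplacian, trace and normal derivative. -/
lemma weak_green {u w : L2Ball} {t n : L2Sphere} (ht : HasTrace u t) (hn : HasNormalDeriv u n)
    (hw : HasWeakLap u w) {η : E4 → ℝ} (hη : ContDiff ℝ ∞ η) :
    ballInt u (lap η) - ballInt w η = sphereInt t (normalD η) - sphereInt n η := by
  obtain ⟨g, hg, k⟩ := ht
  obtain ⟨g', w', hg', hw', k'⟩ := hn
  obtain rfl := hg.unique hg'
  obtain rfl := hw.unique hw'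
  have h1 := k' η hη
  have h2 : ballInt u (lap η) = ∑ i, ballInt u (partialD i (partialD i η)) := by
    rw [lap_eq hη, ballInt_fun_sum _ _ fun i => continuous_partialD i (contDiff_partialD i hη)]
  have h3 : sphereInt t (normalD η) = ∑ i, sphereInt t (fun x => partialD i η x * x i) := by
    rw [← sphereInt_fun_sum _ _ fun i =>
      ((contDiff_partialD i hη).mul (contDiff_coord i)).continuous]
    refine sphereInt_congr t fun x _ => ?_
    simp only [normalD_eq, mul_comm]
  have h4 : ∀ i, ballInt u (partialD i (partialD i η)) + ballInt (g i) (partialD i η) =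
      sphereInt t (fun x => partialD i η x * x i) := fun i => k i _ (contDiff_partialD i hη)
  rw [h2, h3, ← Finset.sum_congr rfl fun i _ => h4 i, Finset.sum_add_distrib]
  linarith

/-! ### Weakly harmonic functions -/

lemma lap_comp_mul {F : ℝ → ℝ} (hF : ContDiff ℝ ∞ F) {r : E4 → ℝ} (hr : ContDiff ℝ ∞ r) (x : E4) :
    lap (fun y => F (1 - ‖y‖ ^ 2) * r y) x = F (1 - ‖x‖ ^ 2) * lap r x
      + deriv F (1 - ‖x‖ ^ 2) * (-4 * normalD r x - 8 * r x)
      + deriv (deriv F) (1 - ‖x‖ ^ 2) * (4 * ‖x‖ ^ 2 * r x) := by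
  have hs : ContDiff ℝ ∞ (fun y : E4 => F (1 - ‖y‖ ^ 2)) :=
    hF.comp (contDiff_const.sub contDiff_normSq)
  rw [lap_mul hs hr, lap_comp_normSq hF]
  simp only [partialD_comp_normSq _ x (hF.differentiable (by simp) _)]
  have : ∑ i, -2 * x i * deriv F (1 - ‖x‖ ^ 2) * partialD i r x =
      -2 * deriv F (1 - ‖x‖ ^ 2) * normalD r x := by
    rw [normalD_eq, Finset.mul_sum]
    exact Finset.sum_congr rfl fun i _ => by ring
  rw [this]
  ring

/-- Only test functions of compact support are available for `w`, which is merely in `L²`. Since `(1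
- |x|²)²` vanishes to second order at the sphere, it is a limit of compactly supported cutoffs with
bounded derivatives up to order two, and dominated convergence passes to the limit. -/
lemma ballInt_lap_eq_zero {w : L2Ball} (hw : HasWeakLap w 0) {r : E4 → ℝ} (hr : ContDiff ℝ ∞ r) :
    ballInt w (lap fun x => (1 - ‖x‖ ^ 2) ^ 2 * r x) = 0 := by
  have hK := isCutoffPow_cutoff 2
  have hK' := hK.deriv (l := 1)
  have hK'' := hK'.deriv (l := 0)
  obtain ⟨C, hC⟩ := hK.bounded
  obtain ⟨C', hC'⟩ := hK'.bounded
  obtain ⟨C'', hC''⟩ := hK''.bounded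
  have hlc := (contDiff_lap hr).continuous
  have hnc := (contDiff_normalD hr).continuous
  have hrc := hr.continuous
  have hGe : ∀ n x, lap (fun y => rescale (cutoff 2) 2 n (1 - ‖y‖ ^ 2) * r y) x =
      rescale (cutoff 2) 2 n (1 - ‖x‖ ^ 2) * lap r x
      + rescale (deriv (cutoff 2)) 1 n (1 - ‖x‖ ^ 2) * (-4 * normalD r x - 8 * r x)
      + rescale (deriv (deriv (cutoff 2))) 0 n (1 - ‖x‖ ^ 2) * (4 * ‖x‖ ^ 2 * r x) :=
    fun n x => by
      rw [lap_comp_mul (contDiff_rescale hK.1 2 n) hr, deriv_rescale hK.1 1 n,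
        deriv_rescale hK'.1 0 n]
  have hbound : Continuous fun x : E4 =>
      C * |lap r x| + C' * |-4 * normalD r x - 8 * r x| + C'' * |4 * ‖x‖ ^ 2 * r x| := by
    fun_prop
  have hlim := tendsto_integral_of_dominated_convergence (μ := ballMeasure)
    (F := fun n x => w x * lap (fun y => rescale (cutoff 2) 2 n (1 - ‖y‖ ^ 2) * r y) x)
    (f := fun x => w x * lap (fun y => (1 - ‖y‖ ^ 2) ^ 2 * r y) x)
    (fun x => |w x| *
      (C * |lap r x| + C' * |-4 * normalD r x - 8 * r x| + C'' * |4 * ‖x‖ ^ 2 * r x|))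
    (fun n => (ball_integrable w (contDiff_lap (isTest_rescale_mul hK 2 n hr).1).continuous).1)
    (by
      refine (ball_integrable w hbound).abs.congr (Filter.Eventually.of_forall fun x => ?_)
      have hC0 : 0 ≤ C := (abs_nonneg _).trans (hC 0 0 le_rfl zero_le_one)
      have hC0' : 0 ≤ C' := (abs_nonneg _).trans (hC' 0 0 le_rfl zero_le_one)
      have hC0'' : 0 ≤ C'' := (abs_nonneg _).trans (hC'' 0 0 le_rfl zero_le_one)
      simp only []
      rw [abs_mul]
      congr 1
      exact abs_of_nonneg (by positivity))
    (fun n => by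
      filter_upwards [ae_restrict_mem measurableSet_ball] with x hx
      have hx1 : ‖x‖ < 1 := by simpa using hx
      have hx0 := norm_nonneg x
      have ha : 0 ≤ 1 - ‖x‖ ^ 2 := by nlinarith
      have hb : 1 - ‖x‖ ^ 2 ≤ 1 := by nlinarith
      rw [hGe, Real.norm_eq_abs, abs_mul]
      refine mul_le_mul_of_nonneg_left ?_ (abs_nonneg _)
      refine (abs_add_le _ _).trans (add_le_add ((abs_add_le _ _).trans (add_le_add ?_ ?_)) ?_)
      · rw [abs_mul]; exact mul_le_mul_of_nonneg_right (hC n _ ha hb) (abs_nonneg _)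
      · rw [abs_mul]; exact mul_le_mul_of_nonneg_right (hC' n _ ha hb) (abs_nonneg _)
      · rw [abs_mul]; exact mul_le_mul_of_nonneg_right (hC'' n _ ha hb) (abs_nonneg _))
    (by
      filter_upwards [ae_restrict_mem measurableSet_ball] with x hx
      have hx1 : ‖x‖ < 1 := by simpa using hx
      have hpos : 0 < 1 - ‖x‖ ^ 2 := by nlinarith [norm_nonneg x]
      simp only [hGe]
      have h1 := (hK.tendsto hpos).mul_const (lap r x)
      have h2 := (hK'.tendsto hpos).mul_const (-4 * normalD r x - 8 * r x)
      have h3 := (hK''.tendsto hpos).mul_const (4 * ‖x‖ ^ 2 * r x)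
      convert ((h1.add h2).add h3).const_mul (w x) using 2
      have hd : deriv (fun s : ℝ => s ^ 2) = fun s => 2 * s := by funext s; simp
      have hd2 : deriv (fun s : ℝ => 2 * s) = fun _ => 2 := by
        funext s; simp
      rw [lap_comp_mul (F := fun s => s ^ 2) (contDiff_id.pow 2) hr, hd, hd2]
      norm_num)
  have hz : ∀ n, ∫ x, w x * lap (fun y => rescale (cutoff 2) 2 n (1 - ‖y‖ ^ 2) * r y) x
      ∂ballMeasure = 0 := fun n => by
    have := hw _ (isTest_rescale_mul hK 2 n hr)
    rwa [ballInt_zero] at this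
  simp only [hz] at hlim
  exact tendsto_nhds_unique hlim tendsto_const_nhds

/-- Fix `q` harmonic of degree `j` and set `a_m = ∫ w |x|^{2m} q`, `c_m = 4(m+1)(m+2+j)`. Testing
with `(1 - |x|²)² |x|^{2(m+1)} q` gives `c_m a_m - 2 c_{m+1} a_{m+1} + c_{m+2} a_{m+2} = 0`, and
testing with `(1 - |x|²)² q` gives `c_1 a_1 = 2 c_0 a_0`. Since `a_0 = 0`, all moments vanish, and
by the Fischer decomposition so do the integrals against all polynomials. -/
lemma eq_zero_of_weakly_harmonic {w : L2Ball} (hw : HasWeakLap w 0)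
    (h : ∀ j, ∀ q ∈ harmonicPolynomials j, ballInt w (polyFun q) = 0) : w = 0 := by
  have h1 : ∀ p, ballFunctional w (polyLap ((1 - rsq) ^ 2 * p)) = 0 := fun p => by
    have := ballInt_lap_eq_zero hw (contDiff_polyFun p)
    have h2 : (fun x : E4 => (1 - ‖x‖ ^ 2) ^ 2 * polyFun p x) = polyFun ((1 - rsq) ^ 2 * p) := by
      funext x
      have := congrFun polyFun_rsq x
      simp only [polyFun, map_mul, map_pow, map_sub, map_one] at this ⊢
      rw [this]
    rw [h2, lap_polyFun] at this
    exact this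
  refine eq_zero_of_ballInt_polyFun fun p => ?_
  change ballFunctional w p = 0
  induction p using polynomial_induction with
  | h m j q hq =>
    have h0 : ballFunctional w q = 0 := h j q hq
    have hc : ∀ m : ℕ, (4 * (m + 1) * (m + 2 + j)) ≠ 0 := fun m => by positivity
    induction m using Nat.twoStepInduction with
    | zero => simpa using h0
    | one =>
      have h3 := h1 q
      have h4 : (1 - rsq) ^ 2 * q = q - 2 • (rsq ^ (0 + 1) * q) + rsq ^ (1 + 1) * q := by
        simp only [nsmul_eq_mul]; push_cast; ring
      have h5 : polyLap q = 0 := by rw [polyLap_apply, hq.2]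
      rw [h4, map_add, map_sub, map_nsmul, polyLap_rsq_pow_mul hq, polyLap_rsq_pow_mul hq, h5,
        map_add, map_sub, map_nsmul, map_nsmul, map_nsmul, pow_zero, one_mul, h0] at h3
      have h6 : (3 + j : ℝ) ≠ 0 := by positivity
      simpa [h6] using h3
    | more m hm hm1 =>
      have h3 := h1 (rsq ^ (m + 1) * q)
      have h4 : (1 - rsq) ^ 2 * (rsq ^ (m + 1) * q) =
          rsq ^ (m + 1) * q - 2 • (rsq ^ (m + 1 + 1) * q) + rsq ^ (m + 2 + 1) * q := by
        simp only [nsmul_eq_mul]; push_cast; ring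
      rw [h4, map_add, map_sub, map_nsmul, polyLap_rsq_pow_mul hq, polyLap_rsq_pow_mul hq,
        polyLap_rsq_pow_mul hq, map_add, map_sub, map_nsmul, map_nsmul, map_nsmul, map_nsmul,
        hm, hm1, smul_zero, smul_zero, smul_zero, sub_zero, zero_add] at h3
      exact (smul_eq_zero.1 h3).resolve_left (hc (m + 2))
  | h0 => exact map_zero _
  | hadd p q hp hq => rw [map_add, hp, hq, add_zero]
  | hsmul c p hp => rw [map_smul, hp, smul_zero]

/-- A biharmonic function with vanishing trace and normal derivative is zero. -/
lemma eq_zero_of_biharmonic {u : L2Ball} (hb : IsBiharmonic u) (ht : HasTrace u 0)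
    (hn : HasNormalDeriv u 0) : u = 0 := by
  obtain ⟨w, hw, hw0⟩ := hb
  have hg : ∀ η, ContDiff ℝ ∞ η → ballInt u (lap η) = ballInt w η := fun η hη => by
    have := weak_green ht hn hw hη
    rw [sphereInt_zero, sphereInt_zero] at this
    linarith
  -- For harmonic `q` the left side of `hg` vanishes, so the harmonic function `w` is orthogonal to
  -- every harmonic polynomial.
  have hwz : w = 0 := eq_zero_of_weakly_harmonic hw0 fun j q hq => by
    rw [← hg _ (contDiff_polyFun q), lap_harmonic hq]
    simp [ballInt]
  refine eq_zero_of_ballInt_polyFun fun p => ?_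
  -- Now `u` is orthogonal to all Laplacians of polynomials, that is, to all polynomials.
  obtain ⟨q, rfl⟩ := polyLap_surjective p
  rw [← lap_polyFun, hg _ (contDiff_polyFun q), hwz, ballInt_zero]

/-! ### Smooth functions as weak functions -/

lemma memLp_ball {f : E4 → ℝ} (hf : Continuous f) : MemLp f 2 ballMeasure := by
  obtain ⟨C, hC⟩ := (isCompact_closedBall (0 : E4) 1).exists_bound_of_continuousOn hf.continuousOn
  refine MemLp.of_bound hf.aestronglyMeasurable C ?_
  filter_upwards [ae_restrict_mem measurableSet_ball] with x hx
  exact hC x (ball_subset_closedBall hx)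

lemma memLp_sphere {f : E4 → ℝ} (hf : Continuous f) :
    MemLp (fun x : S3 => f x) 2 sphereMeasure := by
  obtain ⟨C, hC⟩ := (isCompact_sphere (0 : E4) 1).exists_bound_of_continuousOn hf.continuousOn
  exact MemLp.of_bound (hf.comp continuous_subtype_val).aestronglyMeasurable C
    (Filter.Eventually.of_forall fun x => hC x x.2)

/-- The class in `L²(B⁴)` of a continuous function. -/
noncomputable def toBall (f : E4 → ℝ) (hf : Continuous f) : L2Ball := (memLp_ball hf).toLp f

/-- The class in `L²(S³)` of a continuous function. -/
noncomputable def toSphereL2 (f : E4 → ℝ) (hf : Continuous f) : L2Sphere :=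
  (memLp_sphere hf).toLp _

lemma coeFn_toBall {f : E4 → ℝ} (hf : Continuous f) : toBall f hf =ᵐ[ballMeasure] f :=
  MemLp.coeFn_toLp _

lemma ae_eq_iff_eq_toBall {f : E4 → ℝ} (hf : Continuous f) (u : L2Ball) :
    u =ᵐ[ballMeasure] f ↔ u = toBall f hf := by
  refine ⟨fun h => Lp.ext (h.trans (coeFn_toBall hf).symm), ?_⟩
  rintro rfl
  exact coeFn_toBall hf

lemma ballInt_toBall {f : E4 → ℝ} (hf : Continuous f) (g : E4 → ℝ) :
    ballInt (toBall f hf) g = ∫ x, f x * g x ∂ballMeasure := by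
  refine integral_congr_ae ?_
  filter_upwards [coeFn_toBall hf] with x hx
  rw [hx]

lemma sphereInt_toSphereL2 {f : E4 → ℝ} (hf : Continuous f) (g : E4 → ℝ) :
    sphereInt (toSphereL2 f hf) g = ∫ x : S3, f x * g x ∂sphereMeasure := by
  refine integral_congr_ae ?_
  filter_upwards [MemLp.coeFn_toLp (memLp_sphere hf)] with x hx
  rw [toSphereL2, hx]

lemma toBall_eq_zero_iff {f : E4 → ℝ} (hf : Continuous f) :
    toBall f hf = 0 ↔ ∀ x ∈ ball (0 : E4) 1, f x = 0 := by
  rw [Lp.eq_zero_iff_ae_eq_zero]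
  constructor
  · intro h
    have := Measure.eqOn_open_of_ae_eq ((coeFn_toBall hf).symm.trans h) isOpen_ball hf.continuousOn continuousOn_const
    exact fun x hx => this hx
  · intro h
    filter_upwards [coeFn_toBall hf, ae_restrict_mem measurableSet_ball] with x hx hx'
    rw [hx, h x hx']
    rfl

lemma toBall_congr {f g : E4 → ℝ} (hf : Continuous f) (hg : Continuous g)
    (h : ∀ x ∈ ball (0 : E4) 1, f x = g x) : toBall f hf = toBall g hg := by
  refine Lp.ext ((coeFn_toBall hf).trans (Filter.EventuallyEq.trans ?_ (coeFn_toBall hg).symm))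
  filter_upwards [ae_restrict_mem measurableSet_ball] with x hx using h x hx

lemma toSphereL2_congr {f g : E4 → ℝ} (hf : Continuous f) (hg : Continuous g)
    (h : ∀ x ∈ sphere (0 : E4) 1, f x = g x) : toSphereL2 f hf = toSphereL2 g hg :=
  (MemLp.toLp_eq_toLp_iff _ _).2 (Filter.Eventually.of_forall fun x => h x x.2)

lemma toSphereL2_smul (c : ℝ) {f : E4 → ℝ} (hf : Continuous f) :
    toSphereL2 (fun x => c * f x) (continuous_const.mul hf) = c • toSphereL2 f hf := rfl

lemma integral_ball_parts {f g : E4 → ℝ} (hf : ContDiff ℝ ∞ f) (hg : ContDiff ℝ ∞ g) (i : Fin 4) :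
    ∫ x, f x * partialD i g x ∂ballMeasure + ∫ x, partialD i f x * g x ∂ballMeasure =
      ∫ x : S3, f x * (g x * (x : E4) i) ∂sphereMeasure := by
  rw [← integral_add (integrable_ball (f := fun x => f x * partialD i g x)
    (hf.mul (contDiff_partialD i hg)).continuous)
    (integrable_ball (f := fun x => partialD i f x * g x)
    ((contDiff_partialD i hf).mul hg).continuous)]
  have h := integral_ball_partialD (hf.mul hg) i
  simp only [partialD_mul (smooth_diff hf _) (smooth_diff hg _), mul_assoc] at h
  exact h

lemma hasWeakGrad_toBall {f : E4 → ℝ} (hf : ContDiff ℝ ∞ f) :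
    HasWeakGrad (toBall f hf.continuous)
      fun i => toBall (partialD i f) (continuous_partialD i hf) := by
  intro i η hη
  rw [ballInt_toBall, ballInt_toBall, ← sub_eq_zero, sub_neg_eq_add,
    integral_ball_parts hf hη.1 i]
  refine integral_eq_zero_of_ae (Filter.Eventually.of_forall fun x => ?_)
  have : (x : E4) ∉ tsupport η := fun h => by
    have h1 := hη.2.2 h
    have h2 := mem_sphere_zero_iff_norm.1 x.2
    rw [mem_ball_zero_iff] at h1
    linarith
  simp [image_eq_zero_of_notMem_tsupport this]

lemma hasTrace_toBall {f : E4 → ℝ} (hf : ContDiff ℝ ∞ f) :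
    HasTrace (toBall f hf.continuous) (toSphereL2 f hf.continuous) := by
  refine ⟨_, hasWeakGrad_toBall hf, fun i η hη => ?_⟩
  rw [ballInt_toBall, ballInt_toBall, sphereInt_toSphereL2, integral_ball_parts hf hη i]

lemma memH2_toBall {f : E4 → ℝ} (hf : ContDiff ℝ ∞ f) : MemH2 (toBall f hf.continuous) :=
  ⟨_, hasWeakGrad_toBall hf, fun i => ⟨_, hasWeakGrad_toBall (contDiff_partialD i hf)⟩⟩

/-- Green's first identity for smooth functions. -/
lemma green_first {f g : E4 → ℝ} (hf : ContDiff ℝ ∞ f) (hg : ContDiff ℝ ∞ g) :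
    (∑ i, ∫ x, partialD i f x * partialD i g x ∂ballMeasure) + ∫ x, lap f x * g x ∂ballMeasure =
      ∫ x : S3, normalD f x * g x ∂sphereMeasure := by
  have h1 : ∫ x, lap f x * g x ∂ballMeasure =
      ∑ i, ∫ x, partialD i (partialD i f) x * g x ∂ballMeasure := by
    rw [← integral_finsetSum _ fun i _ => integrable_ball
      (f := fun x => partialD i (partialD i f) x * g x)
      ((contDiff_partialD i (contDiff_partialD i hf)).mul hg).continuous, lap_eq hf]
    simp only [Finset.sum_mul]
  have h2 : ∫ x : S3, normalD f x * g x ∂sphereMeasure =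
      ∑ i, ∫ x : S3, partialD i f x * (g x * (x : E4) i) ∂sphereMeasure := by
    rw [← integral_finsetSum _ fun i _ => integrable_sphere
      (f := fun x => partialD i f x * (g x * x i))
      ((contDiff_partialD i hf).mul (hg.mul (contDiff_coord i))).continuous]
    refine integral_congr_ae (Filter.Eventually.of_forall fun x => ?_)
    simp only [normalD_eq, Finset.sum_mul]
    exact Finset.sum_congr rfl fun i _ => by ring
  rw [h1, h2, ← Finset.sum_add_distrib]
  exact Finset.sum_congr rfl fun i _ => integral_ball_parts (contDiff_partialD i hf) hg i

/-- Green's second identity for smooth functions. -/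
lemma green_second {f g : E4 → ℝ} (hf : ContDiff ℝ ∞ f) (hg : ContDiff ℝ ∞ g) :
    ∫ x, f x * lap g x ∂ballMeasure - ∫ x, lap f x * g x ∂ballMeasure =
      ∫ x : S3, f x * normalD g x ∂sphereMeasure - ∫ x : S3, normalD f x * g x ∂sphereMeasure := by
  have h1 := green_first hf hg
  have h2 := green_first hg hf
  simp only [mul_comm (partialD _ g _), mul_comm (lap g _), mul_comm (normalD g _)] at h2
  linarith

lemma hasWeakLap_toBall {f : E4 → ℝ} (hf : ContDiff ℝ ∞ f) :
    HasWeakLap (toBall f hf.continuous) (toBall (lap f) (contDiff_lap hf).continuous) := by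
  intro η hη
  have h := green_second hf hη.1
  have hz : ∀ x : S3, (x : E4) ∉ tsupport η := fun x h => by
    have h1 := hη.2.2 h
    have h2 := mem_sphere_zero_iff_norm.1 x.2
    rw [mem_ball_zero_iff] at h1
    linarith
  have h3 : ∀ x : S3, η x = 0 := fun x => image_eq_zero_of_notMem_tsupport (hz x)
  have h4 : ∀ x : S3, normalD η x = 0 := fun x => by
    have := (notMem_tsupport_iff_eventuallyEq.1 (hz x)).fderiv_eq (𝕜 := ℝ)
    unfold normalD
    rw [this]
    simp
  simp only [h3, h4, mul_zero, integral_zero, sub_zero] at h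
  rw [ballInt_toBall, ballInt_toBall]
  linarith

lemma hasNormalDeriv_toBall {f : E4 → ℝ} (hf : ContDiff ℝ ∞ f) :
    HasNormalDeriv (toBall f hf.continuous)
      (toSphereL2 (normalD f) (contDiff_normalD hf).continuous) := by
  refine ⟨_, _, hasWeakGrad_toBall hf, hasWeakLap_toBall hf, fun η hη => ?_⟩
  rw [sphereInt_toSphereL2, ballInt_toBall, ← green_first hf hη]
  simp only [ballInt_toBall]

lemma toSphereL2_zero : toSphereL2 (fun _ => 0) continuous_const = 0 := rfl

lemma toBall_zero : toBall (fun _ => 0) continuous_const = 0 := rfl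

lemma isBiharmonic_toBall {f : E4 → ℝ} (hf : ContDiff ℝ ∞ f)
    (h : ∀ x ∈ ball (0 : E4) 1, lap (lap f) x = 0) : IsBiharmonic (toBall f hf.continuous) := by
  refine ⟨_, hasWeakLap_toBall hf, ?_⟩
  have := hasWeakLap_toBall (contDiff_lap hf)
  rwa [toBall_congr (g := fun _ => 0) (contDiff_lap (contDiff_lap hf)).continuous continuous_const
    h, toBall_zero] at this

lemma hasNormalDeriv_zero_toBall {f : E4 → ℝ} (hf : ContDiff ℝ ∞ f)
    (h : ∀ x ∈ sphere (0 : E4) 1, normalD f x = 0) : HasNormalDeriv (toBall f hf.continuous) 0 := by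
  have := hasNormalDeriv_toBall hf
  rwa [toSphereL2_congr (g := fun _ => 0) (contDiff_normalD hf).continuous continuous_const h,
    toSphereL2_zero] at this

/-- Classical solutions are weak solutions. -/
lemma IsClassicalSolution.isSolution {Λ : ℝ} {f : E4 → ℝ} (h : IsClassicalSolution Λ f) :
    IsSolution Λ (toBall f h.1.continuous) := by
  obtain ⟨hf, hb, hP, hn⟩ := h
  have hbi := isBiharmonic_toBall hf hb
  have hlf := contDiff_lap hf
  have hlw : HasWeakLap (toBall (lap f) hlf.continuous) 0 := by
    have := hasWeakLap_toBall hlf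
    rwa [toBall_congr (g := fun _ => 0) (contDiff_lap hlf).continuous continuous_const
      hb, toBall_zero] at this
  refine ⟨memH2_toBall hf, hbi, ⟨_, hasTrace_toBall hf, _, _, _, _, hasWeakLap_toBall hf,
    hlw, hasTrace_toBall hf, hasNormalDeriv_zero_toBall hf hn, fun ψ hψ hψn => ?_⟩,
    hasNormalDeriv_zero_toBall hf hn⟩
  rw [ballInt_zero, sphereInt_zero, sphereInt_smul, ballInt_toBall, sphereInt_toSphereL2,
    sphereInt_toSphereL2, integral_sphere_sphereLap hf hψ]
  have h1 := green_second hlf hψ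
  have h2 : ∫ x, lap (lap f) x * ψ x ∂ballMeasure = 0 := by
    refine integral_eq_zero_of_ae ?_
    filter_upwards [ae_restrict_mem measurableSet_ball] with x hx
    simp [hb x hx]
  have h3 : ∫ x : S3, lap f x * normalD ψ x ∂sphereMeasure = 0 :=
    integral_eq_zero_of_ae (Filter.Eventually.of_forall fun x => by simp [hψn x x.2])
  rw [h2, h3] at h1
  -- The pointwise boundary equation solved for `Δ_{S³} f`; the term `Δ_{S³} ∂_ν f` drops out
  -- because `∂_ν f` vanishes on the whole sphere.
  have h4 : ∀ x : S3, sphereLap f x * ψ x =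
      -(1 / 2) * (normalD (lap f) x * ψ x) - Λ * (f x * ψ x) := fun x => by
    have := hP x x.2
    rw [P3b, sphereLap_eq_zero hn x.2] at this
    linear_combination (-ψ x) * this
  simp only [h4]
  rw [integral_sub ((integrable_sphere (f := fun x => normalD (lap f) x * ψ x)
    ((contDiff_normalD hlf).mul hψ).continuous).const_mul _)
    ((integrable_sphere (f := fun x => f x * ψ x) (hf.mul hψ).continuous).const_mul _),
    integral_const_mul, integral_const_mul]
  linarith

/-! ### The biharmonic extension of a harmonic polynomial -/

/-- The polynomial `½ (k + 2 - k |x|²) p`. -/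
noncomputable def biharmExt (k : ℕ) (p : MvPolynomial (Fin 4) ℝ) : MvPolynomial (Fin 4) ℝ :=
  ((k + 2 : ℝ) / 2) • p - ((k : ℝ) / 2) • (rsq * p)

lemma polyFun_biharmExt (k : ℕ) (p : MvPolynomial (Fin 4) ℝ) :
    polyFun (biharmExt k p) = fun x => ((k + 2 - k * ‖x‖ ^ 2) / 2) * polyFun p x := by
  funext x
  have := congrFun polyFun_rsq x
  simp only [polyFun, biharmExt, map_sub, MvPolynomial.smul_eval, map_mul] at this ⊢
  rw [this]
  ring

lemma polyFun_biharmExt_sphere (k : ℕ) (p : MvPolynomial (Fin 4) ℝ) {x : E4}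
    (hx : x ∈ sphere (0 : E4) 1) : polyFun (biharmExt k p) x = polyFun p x := by
  rw [polyFun_biharmExt]
  simp only [mem_sphere_zero_iff_norm.1 hx]
  ring

/-- The constant is `-(k/2)(8 + 4k)`, from `polyLap_rsq_mul`. -/
lemma polyLap_biharmExt {k : ℕ} {p : MvPolynomial (Fin 4) ℝ} (hp : p ∈ harmonicPolynomials k) :
    polyLap (biharmExt k p) = (-(2 * k * (k + 2)) : ℝ) • p := by
  have h0 : polyLap p = 0 := by rw [polyLap_apply, hp.2]
  rw [biharmExt, map_sub, map_smul, map_smul, h0, smul_zero, zero_sub, polyLap_rsq_mul hp.1, h0,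
    mul_zero, add_zero, ← Nat.cast_smul_eq_nsmul ℝ, smul_smul, ← neg_smul]
  congr 1
  push_cast
  ring

lemma lap_biharmExt {k : ℕ} {p : MvPolynomial (Fin 4) ℝ} (hp : p ∈ harmonicPolynomials k) :
    lap (polyFun (biharmExt k p)) = fun x => -(2 * k * (k + 2)) * polyFun p x := by
  rw [lap_polyFun, polyLap_biharmExt hp, polyFun_smul]

/-- The weights `(k+2)/2` and `-k/2` have sum 1, which fixes the boundary values, and they cancel
the radial derivatives `k p` and `(k+2) p` of the two terms on the sphere. -/
lemma normalD_biharmExt {k : ℕ} {p : MvPolynomial (Fin 4) ℝ} (hp : p ∈ harmonicPolynomials k)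
    {x : E4} (hx : x ∈ sphere (0 : E4) 1) : normalD (polyFun (biharmExt k p)) x = 0 := by
  have h1 : polyFun (biharmExt k p) = fun x => ((k + 2 : ℝ) / 2) * polyFun p x +
      (-(k : ℝ) / 2) * polyFun (rsq * p) x := by
    funext x
    simp only [polyFun, biharmExt, map_sub, MvPolynomial.smul_eval]
    ring
  have h2 : normalD (polyFun p) x = k * polyFun p x := congrFun (normalD_polyFun hp.1) x
  have h3 : normalD (polyFun (rsq * p)) x = (2 + k : ℕ) * polyFun (rsq * p) x :=
    congrFun (normalD_polyFun (isHomogeneous_rsq.mul hp.1)) x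
  have h4 : polyFun (rsq * p) x = polyFun p x := by
    rw [polyFun_mul, polyFun_rsq]
    simp only [mem_sphere_zero_iff_norm.1 hx]
    ring
  have hs := contDiff_polyFun p
  have hs' := contDiff_polyFun (rsq * p)
  have h5 : normalD (polyFun (biharmExt k p)) x = ((k + 2 : ℝ) / 2) * normalD (polyFun p) x +
      (-(k : ℝ) / 2) * normalD (polyFun (rsq * p)) x := by
    unfold normalD
    rw [h1, fderiv_fun_add ((smooth_diff hs x).const_mul _) ((smooth_diff hs' x).const_mul _),
      fderiv_const_mul (smooth_diff hs x), fderiv_const_mul (smooth_diff hs' x)]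
    simp
  rw [h5, h2, h3, h4]
  push_cast
  ring

/-- Only the boundary values matter, so `p` may replace its extension; for harmonic `p` the radial
terms give `-k² - 2k`. -/
lemma sphereLap_biharmExt {k : ℕ} {p : MvPolynomial (Fin 4) ℝ} (hp : p ∈ harmonicPolynomials k)
    {x : E4} (hx : x ∈ sphere (0 : E4) 1) :
    sphereLap (polyFun (biharmExt k p)) x = -(k * (k + 2)) * polyFun p x := by
  have h1 : normalD (normalD (polyFun p)) x = k * (k * polyFun p x) := by
    have h2 : normalD (polyFun p) = polyFun ((k : ℝ) • p) := by
      rw [normalD_polyFun hp.1, polyFun_smul]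
    have h3 : ((k : ℝ) • p).IsHomogeneous k :=
      (MvPolynomial.homogeneousSubmodule (Fin 4) ℝ k).smul_mem _ hp.1
    rw [h2, normalD_polyFun h3, polyFun_smul]
  rw [sphereLap_congr (fun x hx => polyFun_biharmExt_sphere k p hx) hx,
    sphereLap_eq (contDiff_polyFun p) hx, lap_harmonic hp, h1, normalD_polyFun hp.1]
  ring

lemma isClassicalSolution_biharmExt {k : ℕ} {p : MvPolynomial (Fin 4) ℝ}
    (hp : p ∈ harmonicPolynomials k) :
    IsClassicalSolution (k * (k + 1) * (k + 2)) (polyFun (biharmExt k p)) := by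
  refine ⟨contDiff_polyFun _, fun x _ => ?_, fun x hx => ?_, fun x hx => normalD_biharmExt hp hx⟩
  · have h0 : polyLap p = 0 := by rw [polyLap_apply, hp.2]
    rw [lap_polyFun, lap_polyFun, polyLap_biharmExt hp, map_smul, h0]
    simp [polyFun]
  · have h1 : normalD (lap (polyFun (biharmExt k p))) x =
        k * (-(2 * k * (k + 2)) * polyFun p x) := by
      have h3 : ((-(2 * k * (k + 2)) : ℝ) • p).IsHomogeneous k :=
        (MvPolynomial.homogeneousSubmodule (Fin 4) ℝ k).smul_mem _ hp.1
      rw [lap_polyFun, polyLap_biharmExt hp, normalD_polyFun h3, polyFun_smul]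
    rw [P3b, h1, sphereLap_eq_zero (fun x hx => normalD_biharmExt hp hx) hx,
      sphereLap_biharmExt hp hx, polyFun_biharmExt_sphere k p hx]
    ring

/-! ### Fourier analysis on the sphere -/

lemma HasTrace.sub {u u' : L2Ball} {t t' : L2Sphere} (h : HasTrace u t) (h' : HasTrace u' t') :
    HasTrace (u - u') (t - t') := by
  simpa [sub_eq_add_neg] using h.add (h'.smul (-1))

lemma HasNormalDeriv.sub {u u' : L2Ball} {n n' : L2Sphere} (h : HasNormalDeriv u n)
    (h' : HasNormalDeriv u' n') : HasNormalDeriv (u - u') (n - n') := by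
  simpa [sub_eq_add_neg] using h.add (h'.smul (-1))

lemma IsBiharmonic.sub {u u' : L2Ball} (h : IsBiharmonic u) (h' : IsBiharmonic u') :
    IsBiharmonic (u - u') := by
  simpa [sub_eq_add_neg] using h.add (h'.smul (-1))

/-- Restriction of harmonic polynomials to the sphere. -/
noncomputable def harmonicToSphere (k : ℕ) : harmonicSubmodule k →ₗ[ℝ] L2Sphere where
  toFun p := toSphereL2 (polyFun p) (contDiff_polyFun _).continuous
  map_add' p q := (MemLp.toLp_eq_toLp_iff _
    ((memLp_sphere (contDiff_polyFun p.1).continuous).add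
      (memLp_sphere (contDiff_polyFun q.1).continuous))).2
    (Filter.Eventually.of_forall fun x => by simp [polyFun])
  map_smul' c p := (MemLp.toLp_eq_toLp_iff _
    ((memLp_sphere (contDiff_polyFun p.1).continuous).const_smul c)).2
    (Filter.Eventually.of_forall fun x => by simp [polyFun, MvPolynomial.smul_eval])

lemma inner_toSphereL2 (t : L2Sphere) {f : E4 → ℝ} (hf : Continuous f) :
    inner ℝ (toSphereL2 f hf) t = sphereInt t f := by
  rw [L2.inner_def]
  refine integral_congr_ae ?_
  filter_upwards [MemLp.coeFn_toLp (memLp_sphere hf)] with x hx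
  rw [toSphereL2, hx]
  simp

/-- Green's second identity for two harmonic functions reads `0 = (k - j) ∫_S p q`. -/
lemma sphereInt_harmonic_harmonic {j k : ℕ} (hjk : j ≠ k) {p q : MvPolynomial (Fin 4) ℝ}
    (hp : p ∈ harmonicPolynomials j) (hq : q ∈ harmonicPolynomials k) :
    sphereInt (toSphereL2 (polyFun p) (contDiff_polyFun p).continuous) (polyFun q) = 0 := by
  have h := green_second (contDiff_polyFun p) (contDiff_polyFun q)
  rw [lap_harmonic hp, lap_harmonic hq, normalD_polyFun hp.1, normalD_polyFun hq.1] at h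
  simp only [mul_zero, zero_mul, integral_zero, sub_zero, mul_left_comm _ (k : ℝ), mul_assoc,
    integral_const_mul] at h
  rw [sphereInt_toSphereL2]
  rw [eq_comm, ← sub_mul, mul_eq_zero] at h
  refine h.resolve_left (sub_ne_zero.2 ?_)
  exact_mod_cast hjk.symm

/-- Project onto the finite-dimensional space of spherical harmonics of degree `k`. The remainder is
orthogonal to that degree by construction and to the others by hypothesis, hence zero by
completeness. -/
lemma exists_harmonic_of_orthogonal {k : ℕ} {t : L2Sphere}
    (h : ∀ j, j ≠ k → ∀ q ∈ harmonicPolynomials j, sphereInt t (polyFun q) = 0) :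
    ∃ p ∈ harmonicPolynomials k,
      t = toSphereL2 (polyFun p) (contDiff_polyFun p).continuous := by
  obtain ⟨y, ⟨⟨p, hp⟩, rfl⟩, z, hz, hyz⟩ :=
    (LinearMap.range (harmonicToSphere k)).exists_add_mem_mem_orthogonal t
  rw [mem_harmonicSubmodule] at hp
  refine ⟨p, hp, ?_⟩
  suffices z = 0 by rw [hyz, this, add_zero]; rfl
  refine eq_zero_of_sphereInt_harmonic fun j q hq => ?_
  by_cases hj : j = k
  · subst hj
    rw [← inner_toSphereL2 z (contDiff_polyFun q).continuous]
    exact hz _ ⟨⟨q, mem_harmonicSubmodule.2 hq⟩, rfl⟩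
  · have h1 := h j hj q hq
    rw [hyz, sphereInt_add _ _ (contDiff_polyFun q).continuous.continuousOn] at h1
    have h2 : sphereInt (harmonicToSphere k ⟨p, mem_harmonicSubmodule.2 hp⟩) (polyFun q) = 0 :=
      sphereInt_harmonic_harmonic (Ne.symm hj) hp hq
    linarith

/-! ### Solutions of the two problems -/

/-- The extension `½ (k + 2 - k |x|²) p` as an element of `L²(B⁴)`. -/
noncomputable def extBall (k : ℕ) (p : MvPolynomial (Fin 4) ℝ) : L2Ball :=
  toBall (polyFun (biharmExt k p)) (contDiff_polyFun _).continuous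

lemma isSolution_extBall {k : ℕ} {p : MvPolynomial (Fin 4) ℝ} (hp : p ∈ harmonicPolynomials k) :
    IsSolution (k * (k + 1) * (k + 2)) (extBall k p) :=
  (isClassicalSolution_biharmExt hp).isSolution

lemma hasTrace_extBall (k : ℕ) (p : MvPolynomial (Fin 4) ℝ) :
    HasTrace (extBall k p) (toSphereL2 (polyFun p) (contDiff_polyFun p).continuous) := by
  have := hasTrace_toBall (contDiff_polyFun (biharmExt k p))
  rwa [toSphereL2_congr _ (contDiff_polyFun p).continuous
    (fun x hx => polyFun_biharmExt_sphere k p hx)] at this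

lemma eq_extBall {k : ℕ} {p : MvPolynomial (Fin 4) ℝ} (hp : p ∈ harmonicPolynomials k)
    {φ : L2Ball} (hb : IsBiharmonic φ)
    (ht : HasTrace φ (toSphereL2 (polyFun p) (contDiff_polyFun p).continuous))
    (hn : HasNormalDeriv φ 0) : φ = extBall k p := by
  have hs := isSolution_extBall hp
  refine sub_eq_zero.1 (eq_zero_of_biharmonic (hb.sub hs.2.1) ?_ ?_)
  · simpa using ht.sub (hasTrace_extBall k p)
  · simpa using hn.sub hs.2.2.2

/-- The boundary values of a solution are orthogonal to the spherical harmonics of every degree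
`j` with `j (j + 1) (j + 2) ≠ Λ`. -/
lemma IsSolution.exists_trace {Λ : ℝ} {φ : L2Ball} (h : IsSolution Λ φ) :
    ∃ t, HasTrace φ t ∧ ∀ j : ℕ, (j * (j + 1) * (j + 2) : ℝ) ≠ Λ →
      ∀ q ∈ harmonicPolynomials j, sphereInt t (polyFun q) = 0 := by
  obtain ⟨-, ⟨w, hw, hw0⟩, ⟨t, ht, w', z, t', n, hw', hz, ht', hn', hP⟩, hn⟩ := h
  obtain rfl := hw.unique hw'
  obtain rfl := hw0.unique hz
  obtain rfl := ht.unique ht'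
  obtain rfl := hn.unique hn'
  refine ⟨t, ht, fun j hj q hq => ?_⟩
  -- Green against the harmonic `q` itself: `-∫_B w q = j ∫_S t q`.
  have h1 := weak_green ht hn hw (contDiff_polyFun q)
  rw [lap_harmonic hq, normalD_polyFun hq.1, sphereInt_fun_smul, sphereInt_zero] at h1
  have h2 : ballInt φ (fun _ => 0) = 0 := by simp [ballInt]
  -- The extension of `q` is an admissible test function because its normal derivative vanishes. Its
  -- Laplacian is again a multiple of `q`, so the same two integrals appear as in `h1`.
  have h3 := hP _ (contDiff_polyFun (biharmExt j q)) fun x hx => normalD_biharmExt hq hx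
  rw [lap_biharmExt hq, ballInt_fun_smul, ballInt_zero, sphereInt_zero, sphereInt_smul,
    sphereInt_congr t fun x hx => sphereLap_biharmExt hq hx, sphereInt_fun_smul,
    sphereInt_congr t fun x hx => polyFun_biharmExt_sphere j q hx] at h3
  have h4 : (j * (j + 1) * (j + 2) - Λ) * sphereInt t (polyFun q) = 0 := by
    linear_combination h3 - (j * (j + 2) : ℝ) * h1 + (j * (j + 2) : ℝ) * h2
  exact (mul_eq_zero.1 h4).resolve_left (sub_ne_zero.2 hj)

lemma eigenvalue_injective {j k : ℕ}
    (h : (j * (j + 1) * (j + 2) : ℝ) = k * (k + 1) * (k + 2)) : j = k := by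
  have hm : StrictMono fun n : ℕ => n * (n + 1) * (n + 2) := fun a b hab => by
    simp only []
    gcongr
  exact hm.injective (by simpa using (by exact_mod_cast h : j * (j + 1) * (j + 2) = _))

/-- Distinct degrees have distinct eigenvalues, so the trace of a solution is a spherical harmonic
of degree `k`; uniqueness of the biharmonic extension does the rest. -/
lemma mem_eigenspace_iff {k : ℕ} {φ : L2Ball} :
    φ ∈ eigenspace (k * (k + 1) * (k + 2)) ↔ ∃ p ∈ harmonicPolynomials k, φ = extBall k p := by
  constructor
  · intro h
    obtain ⟨t, ht, hto⟩ := IsSolution.exists_trace h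
    obtain ⟨p, hp, rfl⟩ := exists_harmonic_of_orthogonal (k := k) (t := t)
      fun j hj => hto j fun he => hj (eigenvalue_injective he)
    exact ⟨p, hp, eq_extBall hp h.2.1 ht h.2.2.2⟩
  · rintro ⟨p, hp, rfl⟩
    exact isSolution_extBall hp

lemma eigenspace_eq_bot {Λ : ℝ} (h : ∀ k : ℕ, Λ ≠ k * (k + 1) * (k + 2)) :
    eigenspace Λ = ⊥ := by
  refine (Submodule.eq_bot_iff _).2 fun φ hφ => ?_
  obtain ⟨t, ht, hto⟩ := IsSolution.exists_trace hφ
  have ht0 : t = 0 := eq_zero_of_sphereInt_harmonic fun j => hto j (h j).symm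
  subst ht0
  exact eq_zero_of_biharmonic hφ.2.1 ht hφ.2.2.2

/-- The extension operator from harmonic polynomials to `L²(B⁴)`. -/
noncomputable def extLinear (k : ℕ) : harmonicSubmodule k →ₗ[ℝ] L2Ball where
  toFun p := extBall k p
  map_add' p q := (MemLp.toLp_eq_toLp_iff
    (memLp_ball (contDiff_polyFun (biharmExt k (p + q).1)).continuous)
    ((memLp_ball (contDiff_polyFun (biharmExt k p)).continuous).add
      (memLp_ball (contDiff_polyFun (biharmExt k q)).continuous))).2
    (Filter.Eventually.of_forall fun x => by
      simp only [Pi.add_apply, polyFun_biharmExt, Submodule.coe_add, polyFun_add]; ring)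
  map_smul' c p := (MemLp.toLp_eq_toLp_iff
    (memLp_ball (contDiff_polyFun (biharmExt k (c • p).1)).continuous)
    ((memLp_ball (contDiff_polyFun (biharmExt k p)).continuous).const_smul c)).2
    (Filter.Eventually.of_forall fun x => by
      simp only [Pi.smul_apply, polyFun_biharmExt, Submodule.coe_smul, polyFun_smul, smul_eq_mul]
      ring)

/-- Inside the ball the factor `½ (k + 2 - k |x|²)` is at least 1, so `p` vanishes wherever its
extension does. -/
lemma extLinear_injective (k : ℕ) : Function.Injective (extLinear k) := by
  refine (injective_iff_map_eq_zero _).2 fun p hp => Subtype.ext ?_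
  refine eq_zero_of_polyFun_eq_zero_on_ball (mem_harmonicSubmodule.1 p.2).1 fun x hx => ?_
  have h := (toBall_eq_zero_iff (contDiff_polyFun (biharmExt k p)).continuous).1 hp x hx
  rw [polyFun_biharmExt] at h
  refine (mul_eq_zero.1 h).resolve_left ?_
  have hx1 : ‖x‖ ^ 2 ≤ 1 := pow_le_one₀ (norm_nonneg x) (mem_ball_zero_iff.1 hx).le
  have hk : (0 : ℝ) ≤ k := k.cast_nonneg
  have : 0 < (k + 2 - k * ‖x‖ ^ 2) / 2 := by nlinarith
  exact this.ne'

lemma finrank_eigenspace (k : ℕ) :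
    Module.finrank ℝ (eigenspace (k * (k + 1) * (k + 2))) = (k + 1) ^ 2 := by
  have : eigenspace (k * (k + 1) * (k + 2)) = LinearMap.range (extLinear k) := by
    ext φ
    rw [mem_eigenspace_iff]
    constructor
    · rintro ⟨p, hp, rfl⟩
      exact ⟨⟨p, mem_harmonicSubmodule.2 hp⟩, rfl⟩
    · rintro ⟨p, rfl⟩
      exact ⟨p, mem_harmonicSubmodule.1 p.2, rfl⟩
  rw [this, LinearMap.finrank_range_of_inj (extLinear_injective k), finrank_harmonicSubmodule]

lemma isEigenvalue_iff {Λ : ℝ} : IsEigenvalue Λ ↔ eigenspace Λ ≠ ⊥ := by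
  rw [Submodule.ne_bot_iff]
  exact ⟨fun ⟨φ, h0, h⟩ => ⟨φ, h, h0⟩, fun ⟨φ, h, h0⟩ => ⟨φ, h0, h⟩⟩

/-! ### Steklov solutions, biharmonic extensions and classical solutions -/

lemma isSteklovSolution_iff {k : ℕ} {ψ : L2Ball} :
    IsSteklovSolution k ψ ↔ ∃ p ∈ harmonicPolynomials k,
      ψ = toBall (polyFun p) (contDiff_polyFun p).continuous := by
  have hpoly : ∀ p ∈ harmonicPolynomials k,
      HasWeakLap (toBall (polyFun p) (contDiff_polyFun p).continuous) 0 ∧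
      HasNormalDeriv (toBall (polyFun p) (contDiff_polyFun p).continuous)
        ((k : ℝ) • toSphereL2 (polyFun p) (contDiff_polyFun p).continuous) := fun p hp => by
    have h1 := hasWeakLap_toBall (contDiff_polyFun p)
    have h2 := hasNormalDeriv_toBall (contDiff_polyFun p)
    rw [toBall_congr (g := fun _ => 0) (contDiff_lap (contDiff_polyFun p)).continuous
      continuous_const (fun x _ => by rw [lap_harmonic hp]), toBall_zero] at h1
    rw [toSphereL2_congr (g := fun x => k * polyFun p x)
      (contDiff_normalD (contDiff_polyFun p)).continuous
      (continuous_const.mul (contDiff_polyFun p).continuous)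
      (fun x _ => congrFun (normalD_polyFun hp.1) x),
      toSphereL2_smul _ (contDiff_polyFun p).continuous] at h2
    exact ⟨h1, h2⟩
  constructor
  · rintro ⟨hl, t, ht, hn⟩
    have hto : ∀ j, j ≠ k → ∀ q ∈ harmonicPolynomials j, sphereInt t (polyFun q) = 0 :=
      fun j hj q hq => by
        have h1 := weak_green ht hn hl (contDiff_polyFun q)
        rw [lap_harmonic hq, normalD_polyFun hq.1, sphereInt_fun_smul, sphereInt_smul,
          ballInt_zero] at h1
        have h2 : ballInt ψ (fun _ => 0) = 0 := by simp [ballInt]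
        -- Green's identity for two harmonic functions, with normal derivatives `k t` and `j q`.
        have h3 : ((j : ℝ) - k) * sphereInt t (polyFun q) = 0 := by linarith
        exact (mul_eq_zero.1 h3).resolve_left (sub_ne_zero.2 (by exact_mod_cast hj))
    obtain ⟨p, hp, rfl⟩ := exists_harmonic_of_orthogonal hto
    obtain ⟨hpl, hpn⟩ := hpoly p hp
    -- Harmonic functions are biharmonic, and here both trace and normal derivative agree with those
    -- of `p`, so biharmonic uniqueness suffices.
    refine ⟨p, hp, sub_eq_zero.1 (eq_zero_of_biharmonic (IsBiharmonic.sub ⟨0, hl, ?_⟩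
      ⟨0, hpl, ?_⟩) ?_ ?_)⟩
    · intro η _; rw [ballInt_zero, ballInt_zero]
    · intro η _; rw [ballInt_zero, ballInt_zero]
    · simpa using ht.sub (hasTrace_toBall (contDiff_polyFun p))
    · simpa using hn.sub hpn
  · rintro ⟨p, hp, rfl⟩
    exact ⟨(hpoly p hp).1, _, hasTrace_toBall (contDiff_polyFun p), (hpoly p hp).2⟩

lemma isNeumannBiharmonicExtension_iff {k : ℕ} {p : MvPolynomial (Fin 4) ℝ}
    (hp : p ∈ harmonicPolynomials k) {φ : L2Ball} :
    IsNeumannBiharmonicExtension φ (toBall (polyFun p) (contDiff_polyFun p).continuous) ↔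
      φ = extBall k p := by
  have htr := hasTrace_toBall (contDiff_polyFun p)
  constructor
  · rintro ⟨-, hb, hn, t, ht, ht'⟩
    obtain rfl := ht.unique htr
    exact eq_extBall hp hb ht' hn
  · rintro rfl
    have h := isSolution_extBall hp
    exact ⟨h.1, h.2.1, h.2.2.2, _, htr, hasTrace_extBall k p⟩

lemma isClassicalSolution_zero (Λ : ℝ) : IsClassicalSolution Λ fun _ => 0 := by
  have h1 : lap (fun _ : E4 => (0 : ℝ)) = fun _ => 0 := by
    funext x; simp [lap]
  have h2 : normalD (fun _ : E4 => (0 : ℝ)) = fun _ => 0 := by funext y; simp [normalD]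
  refine ⟨contDiff_const, fun x _ => ?_, fun x hx => ?_, fun x _ => ?_⟩
  · simp [h1]
  · rw [P3b, h1, h2, sphereLap_eq_zero (fun _ _ => rfl) hx]
    simp
  · simp [h2]

lemma mem_eigenspace_iff_classical {Λ : ℝ} {φ : L2Ball} :
    φ ∈ eigenspace Λ ↔ ∃ f : E4 → ℝ, IsClassicalSolution Λ f ∧ φ =ᵐ[ballMeasure] f := by
  constructor
  · intro h
    by_cases hΛ : ∃ k : ℕ, Λ = k * (k + 1) * (k + 2)
    · obtain ⟨k, rfl⟩ := hΛ
      obtain ⟨p, hp, rfl⟩ := mem_eigenspace_iff.1 h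
      exact ⟨_, isClassicalSolution_biharmExt hp, coeFn_toBall _⟩
    · push Not at hΛ
      rw [eigenspace_eq_bot hΛ, Submodule.mem_bot] at h
      subst h
      exact ⟨_, isClassicalSolution_zero Λ, (ae_eq_iff_eq_toBall continuous_const 0).2 rfl⟩
  · rintro ⟨f, hf, hφ⟩
    rw [(ae_eq_iff_eq_toBall hf.1.continuous φ).1 hφ]
    exact hf.isSolution

/-! ### Listing the spectrum -/

/-- The number of eigenvalues, with multiplicity, below the `k`-th one. -/
def multSum (k : ℕ) : ℕ := ∑ j ∈ Finset.range k, (j + 1) ^ 2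

lemma multSum_strictMono : StrictMono multSum :=
  strictMono_nat_of_lt_succ fun _ => by
    unfold multSum
    rw [Finset.sum_range_succ]
    exact Nat.lt_add_of_pos_right (by positivity)

lemma exists_lt_multSum (i : ℕ) : ∃ k, i < multSum (k + 1) :=
  ⟨i, multSum_strictMono.le_apply⟩

/-- The index of the eigenvalue in position `i`. -/
def level (i : ℕ) : ℕ := Nat.find (exists_lt_multSum i)

lemma level_le_iff {i k : ℕ} : level i ≤ k ↔ i < multSum (k + 1) := by
  rw [level, Nat.find_le_iff]
  constructor
  · rintro ⟨m, hm, h⟩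
    exact h.trans_le (multSum_strictMono.monotone (by omega))
  · intro h
    exact ⟨k, le_rfl, h⟩

/-- Level `k` occupies exactly the positions from `multSum k` up to `multSum (k + 1)`, a block of
length `(k + 1)²`, which is the multiplicity. -/
lemma level_eq_iff {i k : ℕ} : level i = k ↔ multSum k ≤ i ∧ i < multSum (k + 1) := by
  rw [← level_le_iff]
  cases k with
  | zero => simp [multSum]
  | succ k =>
    have := level_le_iff (i := i) (k := k)
    omega

lemma level_monotone : Monotone level := fun _ _ hij =>
  level_le_iff.2 (hij.trans_lt (level_le_iff.1 le_rfl))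

lemma encard_level (k : ℕ) : {i | level i = k}.encard = ((k + 1) ^ 2 : ℕ) := by
  have : {i | level i = k} = (Finset.Ico (multSum k) (multSum (k + 1)) : Set ℕ) := by
    ext i; simp [level_eq_iff]
  rw [this, Set.encard_coe_eq_coe_finsetCard, Nat.card_Ico]
  unfold multSum
  rw [Finset.sum_range_succ, Nat.add_sub_cancel_left]

lemma exists_spectrum_listing :
    ∃ Λ : ℕ → ℝ, Monotone Λ ∧
      (∀ μ : ℝ, {i | Λ i = μ}.encard = (Module.finrank ℝ (eigenspace μ) : ℕ∞)) ∧
      Λ 0 = 0 ∧ Λ 1 = 6 ∧ Λ 2 = 6 ∧ Λ 3 = 6 ∧ Λ 4 = 6 ∧ Λ 5 = 24 := by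
  have hl : ∀ i k, multSum k ≤ i → i < multSum (k + 1) → level i = k :=
    fun i k h1 h2 => level_eq_iff.2 ⟨h1, h2⟩
  refine ⟨fun i => level i * (level i + 1) * (level i + 2), fun _ _ hij => ?_, fun μ => ?_, ?_⟩
  · have := level_monotone hij
    simp only []
    gcongr
  · by_cases hμ : ∃ k : ℕ, μ = k * (k + 1) * (k + 2)
    · obtain ⟨k, rfl⟩ := hμ
      rw [finrank_eigenspace, ← encard_level]
      congr 1
      ext i
      exact ⟨fun h => eigenvalue_injective h, fun h => by
        rw [mem_ofPred_eq] at h ⊢; simp only [h]⟩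
    · push Not at hμ
      -- A number that is not an eigenvalue has the zero eigenspace, of rank 0, so it must not occur
      -- in the list.
      rw [eigenspace_eq_bot hμ, finrank_bot, Nat.cast_zero, encard_eq_zero]
      exact eq_empty_of_forall_notMem fun i hi => hμ (level i) hi.symm
  · simp only []
    rw [hl 0 0, hl 1 1, hl 2 1, hl 3 1, hl 4 1, hl 5 2] <;>
      norm_num [multSum, Finset.sum_range_succ]

end FlatBall

theorem proposition4p1 :
    -- the eigenvalues are exactly the numbers `k (k + 1) (k + 2)`
    (∀ Λ : ℝ, FlatBall.IsEigenvalue Λ ↔ ∃ k : ℕ, Λ = k * (k + 1) * (k + 2)) ∧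
    -- multiplicities
    (∀ k : ℕ, Module.finrank ℝ (FlatBall.eigenspace (k * (k + 1) * (k + 2))) = (k + 1) ^ 2) ∧
    -- the eigenspaces in terms of the Steklov eigenfunctions with Steklov eigenvalue `k`
    (∀ k : ℕ,
      (∀ ψ : FlatBall.L2Ball, FlatBall.IsSteklovSolution k ψ →
        ∃! φ : FlatBall.L2Ball, FlatBall.IsNeumannBiharmonicExtension φ ψ) ∧
      (FlatBall.eigenspace (k * (k + 1) * (k + 2)) : Set FlatBall.L2Ball) =
        {φ | ∃ ψ : FlatBall.L2Ball, FlatBall.IsSteklovSolution k ψ ∧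
          FlatBall.IsNeumannBiharmonicExtension φ ψ}) ∧
    -- both families in terms of homogeneous harmonic polynomials of degree `k`
    (∀ k : ℕ,
      (∀ ψ : FlatBall.L2Ball, FlatBall.IsSteklovSolution k ψ ↔
        ∃ p ∈ FlatBall.harmonicPolynomials k,
          ψ =ᵐ[FlatBall.ballMeasure] fun x => MvPolynomial.eval (fun i => x i) p) ∧
      (∀ φ : FlatBall.L2Ball, φ ∈ FlatBall.eigenspace (k * (k + 1) * (k + 2)) ↔
        ∃ p ∈ FlatBall.harmonicPolynomials k,
          φ =ᵐ[FlatBall.ballMeasure] fun x =>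
            ((k + 2 - k * ‖x‖ ^ 2) / 2) * MvPolynomial.eval (fun i => x i) p)) ∧
    -- the solutions in `H²` are the classical solutions
    (∀ (Λ : ℝ) (φ : FlatBall.L2Ball), φ ∈ FlatBall.eigenspace Λ ↔
      ∃ f : FlatBall.E4 → ℝ, FlatBall.IsClassicalSolution Λ f ∧
        φ =ᵐ[FlatBall.ballMeasure] f) ∧
    -- the beginning of the spectrum, listed in nondecreasing order with multiplicity
    (∃ Λ : ℕ → ℝ, Monotone Λ ∧
      (∀ μ : ℝ, {i | Λ i = μ}.encard = (Module.finrank ℝ (FlatBall.eigenspace μ) : ℕ∞)) ∧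
      Λ 0 = 0 ∧ Λ 1 = 6 ∧ Λ 2 = 6 ∧ Λ 3 = 6 ∧ Λ 4 = 6 ∧ Λ 5 = 24) := by
  refine ⟨fun Λ => ?_, FlatBall.finrank_eigenspace, fun k => ⟨fun ψ hψ => ?_, ?_⟩,
    fun k => ⟨fun ψ => ?_, fun φ => ?_⟩, fun Λ φ => FlatBall.mem_eigenspace_iff_classical,
    FlatBall.exists_spectrum_listing⟩
  · rw [FlatBall.isEigenvalue_iff]
    constructor
    · intro h
      by_contra! hk
      exact h (FlatBall.eigenspace_eq_bot hk)
    · rintro ⟨k, rfl⟩ h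
      -- A zero eigenspace would contradict its dimension `(k + 1)² > 0`.
      have h1 := FlatBall.finrank_eigenspace k
      rw [h, finrank_bot] at h1
      exact absurd h1.symm (by positivity)
  · obtain ⟨p, hp, rfl⟩ := FlatBall.isSteklovSolution_iff.1 hψ
    exact ⟨_, (FlatBall.isNeumannBiharmonicExtension_iff hp).2 rfl,
      fun φ hφ => (FlatBall.isNeumannBiharmonicExtension_iff hp).1 hφ⟩
  · ext φ
    rw [SetLike.mem_coe, FlatBall.mem_eigenspace_iff]
    constructor
    · rintro ⟨p, hp, rfl⟩
      exact ⟨_, FlatBall.isSteklovSolution_iff.2 ⟨p, hp, rfl⟩,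
        (FlatBall.isNeumannBiharmonicExtension_iff hp).2 rfl⟩
    · rintro ⟨ψ, hψ, hφ⟩
      obtain ⟨p, hp, rfl⟩ := FlatBall.isSteklovSolution_iff.1 hψ
      exact ⟨p, hp, (FlatBall.isNeumannBiharmonicExtension_iff hp).1 hφ⟩
  · rw [FlatBall.isSteklovSolution_iff]
    exact exists_congr fun p => and_congr_right fun _ =>
      (FlatBall.ae_eq_iff_eq_toBall (FlatBall.contDiff_polyFun p).continuous ψ).symm
  · rw [FlatBall.mem_eigenspace_iff]
    refine exists_congr fun p => and_congr_right fun _ => ?_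
    have h : (fun x : FlatBall.E4 => ((k + 2 - k * ‖x‖ ^ 2) / 2) *
        MvPolynomial.eval (fun i => x i) p) = FlatBall.polyFun (FlatBall.biharmExt k p) :=
      (FlatBall.polyFun_biharmExt k p).symm
    rw [h]
    exact (FlatBall.ae_eq_iff_eq_toBall
      (FlatBall.contDiff_polyFun (FlatBall.biharmExt k p)).continuous φ).symm
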